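/- Consider the control system $\dot x=A(x)+B(x)u$, $u\in\mathcal U\subseteq\mathbb R^m$, $x\in\mathbb R^n$, with $A$, $B$ locally Lipschitz, and a locally Lipschitz running cost $g(x,u)$ with $g(x,u)>0$ for $(x,u)\neq(0,0)$. Let $\Phi:\mathbb R^n\to\mathbb R$ be smooth and positive definite, let $\kappa>0$ be such that $\mathcal P=\{x:\Phi(x)\le\kappa\}$ is bounded, and assume the HJB-like inequality $$\min_{u\in\mathcal U}\{\nabla\Phi(x)[A(x)+B(x)u]+g(x,u)\}\le 0\qquad\text{for all }x\in\mathcal P .$$ For $T>0$ consider the finite-horizon problem $$\Psi_T(x_0)=\inf\int_0^T g(x(\tau),u(\tau))\,d\tau+\Phi(x(T))$$ over all bounded measurable controls $u:[0,T]\to\mathcal U$ and solutions of $\dot x=A(x)+B(x)u$ on $[0,T]$ with $x(0)=x_0$ and $x(T)\in\mathcal P$. Let $\mathcal F_T$ be the set of $x_0$ for which such a pair $(x,u)$ exists, and let $\Psi_T=+\infty$ outside $\mathcal F_T$. (1) The problem is recursively feasible: if $(x,u)$ is a feasible pair from $x_0$ (for instance an optimal one), then $x(\tau)\in\mathcal F_T$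 for every $\tau\in[0,T]$. Now let $\omega$ be an optimal control which is continuous on $\mathcal F_T$; that is, for every $x_0\in\mathcal F_T$ the infimum is attained by a feasible pair whose control $u$ has initial value $\omega(x_0)=u(0)=\lim_{t\to0^+}u(t)$. (2) For every $x\in\mathcal F_T$, $$D^+\Psi_T(x,\omega(x)):=\limsup_{h\to0^+}\frac{\Psi_T\bigl(x+h(A(x)+B(x)\omega(x))\bigr)-\Psi_T(x)}{h}\le -g(x,\omega(x)).$$ (3) Let $x_0\in\mathcal F_T$ and let $x$ be a solution of the closed loop $\dot x=A(x)+B(x)\omega(x)$, $x(0)=x_0$, on $[0,\infty)$, along which $t\mapsto\Psi_T(x(t))\in[0,\infty]$ is lower semicontinuous (for instance because $\Psi_T$ is lower semicontinuous on $\mathbb R^n$, or because $x$ stays in $\mathcal F_T$ and $\Psi_T$ is continuous on $\mathcal F_T$). Then $x(t)\in\mathcal F_T$ for all $t\ge0$ and $$\int_0^\infty g(x(t),\omega(x(t)))\,dt\le\Psi_T(x_0).$$ The same holds on $[0,S)$, with $\int_0^S$ in place of $\int_0^\infty$, for closed-loop solutions that are only defined on $[0,S)$. -/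

import Mathlib

open MeasureTheory Set Filter Topology
open scoped ENNReal

/-- The data of the finite-horizon model predictive scheme for `ẋ = A(x) + B(x) u`, `u ∈ U`:
running cost `g`, terminal cost `Φ`, level `κ` of the terminal set `{Φ ≤ κ}`, horizon `T`.
No property of the data is built in. -/
structure MPCProblem (n m : ℕ) where
  A : EuclideanSpace ℝ (Fin n) → EuclideanSpace ℝ (Fin n)
  B : EuclideanSpace ℝ (Fin n) → (EuclideanSpace ℝ (Fin m) →L[ℝ] EuclideanSpace ℝ (Fin n))
  U : Set (EuclideanSpace ℝ (Fin m))
  g : EuclideanSpace ℝ (Fin n) → EuclideanSpace ℝ (Fin m) → ℝ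
  Φ : EuclideanSpace ℝ (Fin n) → ℝ
  κ : ℝ
  T : ℝ

namespace MPCProblem

variable {n m : ℕ} (M : MPCProblem n m)

/-- The velocity `A(x) + B(x) u`. -/
def field (x : EuclideanSpace ℝ (Fin n)) (u : EuclideanSpace ℝ (Fin m)) :
    EuclideanSpace ℝ (Fin n) :=
  M.A x + M.B x u

/-- The terminal set `𝒫 = {x : Φ(x) ≤ κ}`. -/
def terminalSet : Set (EuclideanSpace ℝ (Fin n)) := {x | M.Φ x ≤ M.κ}

/-- The HJB-like inequality on the terminal set:
`min_{u ∈ U} {∇Φ(x) [A(x) + B(x) u] + g(x,u)} ≤ 0` for every `x ∈ 𝒫`. -/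
def TerminalInequality : Prop :=
  ∀ x ∈ M.terminalSet, ∃ u ∈ M.U, fderiv ℝ M.Φ x (M.field x u) + M.g x u ≤ 0

/-- `(x, u)` satisfies the constraints of the finite-horizon problem with initial state `x₀`:
`u` is a bounded measurable control with values in `U` on `[0,T]`, `x` is a (Carathéodory) solution
of `ẋ = A(x) + B(x) u` on `[0,T]` with `x(0) = x₀`, and `x(T) ∈ 𝒫`. -/
structure IsFeasiblePair (x₀ : EuclideanSpace ℝ (Fin n))
    (x : ℝ → EuclideanSpace ℝ (Fin n)) (u : ℝ → EuclideanSpace ℝ (Fin m)) : Prop where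
  measurable_control : Measurable u
  bounded_control : ∃ C : ℝ, ∀ t ∈ Icc 0 M.T, ‖u t‖ ≤ C
  control_mem : ∀ t ∈ Icc 0 M.T, u t ∈ M.U
  continuousOn_state : ContinuousOn x (Icc 0 M.T)
  state_eq : ∀ t ∈ Icc 0 M.T, x t = x₀ + ∫ s in (0 : ℝ)..t, M.field (x s) (u s)
  terminal_mem : x M.T ∈ M.terminalSet

/-- The states at which the finite-horizon problem is feasible. -/
def feasibleSet : Set (EuclideanSpace ℝ (Fin n)) :=
  {x₀ | ∃ x u, M.IsFeasiblePair x₀ x u}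

/-- The cost `∫₀ᵀ g(x(τ),u(τ)) dτ + Φ(x(T))`, as an extended nonnegative number. -/
noncomputable def cost (x : ℝ → EuclideanSpace ℝ (Fin n)) (u : ℝ → EuclideanSpace ℝ (Fin m)) :
    ℝ≥0∞ :=
  (∫⁻ t in Icc 0 M.T, ENNReal.ofReal (M.g (x t) (u t))) + ENNReal.ofReal (M.Φ (x M.T))

/-- The value function `Ψ_T`; it is `∞` where the problem is infeasible. -/
noncomputable def value (x₀ : EuclideanSpace ℝ (Fin n)) : ℝ≥0∞ :=
  ⨅ (x : ℝ → EuclideanSpace ℝ (Fin n)) (u : ℝ → EuclideanSpace ℝ (Fin m))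
    (_ : M.IsFeasiblePair x₀ x u), M.cost x u

/-- Feasibility is inherited by every state that is reached within the horizon along a feasible
(in particular, along an optimal) solution. -/
def RecursivelyFeasible : Prop :=
  ∀ x₀ x u, M.IsFeasiblePair x₀ x u → ∀ τ ∈ Icc 0 M.T, x τ ∈ M.feasibleSet

/-- `ω` is the optimal (receding-horizon) control: at every feasible state `x₀` the minimum is
attained by an open-loop solution whose control has the initial value `ω(x₀)`. As controls are
otherwise only measurable, the initial value is required to be the limit as time tends to `0`. -/
def IsOptimalControl (ω : EuclideanSpace ℝ (Fin n) → EuclideanSpace ℝ (Fin m)) : Prop :=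
  ∀ x₀ ∈ M.feasibleSet, ∃ x u, M.IsFeasiblePair x₀ x u ∧ M.cost x u = M.value x₀ ∧
    u 0 = ω x₀ ∧ ContinuousWithinAt u (Ici 0) 0

/-- The generalized directional derivative
`D⁺V(x,u) = limsup_{h → 0⁺} (V(x + h (A(x) + B(x) u)) - V(x)) / h`
of a function with values in `[0,∞]` (meaningful where `V x` is finite). -/
noncomputable def upperDeriv (V : EuclideanSpace ℝ (Fin n) → ℝ≥0∞)
    (x : EuclideanSpace ℝ (Fin n)) (u : EuclideanSpace ℝ (Fin m)) : EReal :=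
  limsup (fun h : ℝ => ((V (x + h • M.field x u) : EReal) - (V x : EReal)) / (h : EReal)) (𝓝[>] 0)

/-- `x` solves the closed loop `ẋ = A(x) + B(x) ω(x)`, `x(0) = x₀`, on the time interval `I`. -/
def IsClosedLoop (ω : EuclideanSpace ℝ (Fin n) → EuclideanSpace ℝ (Fin m)) (I : Set ℝ)
    (x₀ : EuclideanSpace ℝ (Fin n)) (x : ℝ → EuclideanSpace ℝ (Fin n)) : Prop :=
  x 0 = x₀ ∧ ∀ t ∈ I, HasDerivWithinAt x (M.field (x t) (ω (x t))) I t

end MPCProblem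

/-- The time interval `[0,S)`, where `S = ⊤` gives `[0,∞)`. -/
def timeInterval (S : EReal) : Set ℝ := {t | 0 ≤ t ∧ (t : EReal) < S}

/-!
The value function is estimated by explicit competitors; nothing is assumed of its regularity
except lower semicontinuity along the closed-loop solution.

*Continuing a feasible pair.* The terminal inequality provides, for every `z` in the terminal set
`𝒫`, one admissible value `v` with `∇Φ(z)[A(z) + B(z) v] + g(z, v) ≤ 0`. By continuity the constant
control `v` pays, from all states near `z` and for a short time, its running cost by a decrease of
`Φ`, up to a small error (`exists_isPath_descent`). Where `Φ(z) = κ` the running cost is positive,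
so `Φ` decreases at a positive rate; hence states that are near `z` and only slightly outside `𝒫`
are also brought back (`exists_isPath_terminal_near`). As `𝒫` is compact the time steps can be
chosen uniformly, which makes `𝒫` viable, and the problem recursively feasible.

*Decrease of the value function.* Let `(x, u)` be an optimal pair from `x₀`, with `u` continuous
at `0`, and let `y` be a curve from `x₀` with initial velocity `A(x₀) + B(x₀) u(0)`. Then
`y(h) = x(h) + o(h)`. From `y(h)` one may follow `u` on `[h, T]`; this produces a trajectory at
distance `o(h)` from `x`, which ends at distance `o(h)` from `x(T) ∈ 𝒫`, and then takes the time
`h` to return to `𝒫` as above. The total cost is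
`Ψ(x₀) - ∫₀ʰ g(x, u) + o(h) = Ψ(x₀) - h g(x₀, u(0)) + o(h)`; this is `eventually_value_add_le`.
With a straight line `y` it is the bound on the generalized directional derivative. With `y` a
closed-loop solution it bounds the right upper derivative of `Ψ` along that solution, and a
continuous induction, in which lower semicontinuity makes the set of good times closed, integrates
the bound (`add_setLIntegral_le_of_eventually_add_le`).

Controls are merely measurable, so existence and Lipschitz dependence of trajectories are proved
for Carathéodory equations, by a contraction argument in a weighted norm
(`exists_integral_solution_near`).
-/

/-! ### Integral equations with a measurable time dependence -/

/-- **Existence and shadowing for Carathéodory equations.** Let `F t` be `L`-Lipschitz for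
`t ∈ [0, s]`. Near every curve `ξ` that solves `y t = y₀ + ∫₀ᵗ F r (y r) dr` up to an error `e`
there is an exact solution, at distance at most `2 exp (2 L s) e`. The time dependence need only
be integrable along continuous curves, so that measurable controls are allowed. -/
theorem exists_integral_solution_near {E : Type*} [NormedAddCommGroup E] [NormedSpace ℝ E]
    [CompleteSpace E] {F : ℝ → E → E} {L s e : ℝ} (hs : 0 ≤ s) (hL : 0 < L)
    (hF : ∀ t ∈ Icc 0 s, ∀ p q, ‖F t p - F t q‖ ≤ L * ‖p - q‖)
    (hint : ∀ x : ℝ → E, Continuous x → IntervalIntegrable (fun t => F t (x t)) volume 0 s)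
    {ξ : ℝ → E} (hξ : Continuous ξ) (y₀ : E)
    (hdef : ∀ t ∈ Icc 0 s, ‖y₀ + (∫ r in (0 : ℝ)..t, F r (ξ r)) - ξ t‖ ≤ e) :
    ∃ y : ℝ → E, Continuous y ∧ (∀ t ∈ Icc 0 s, y t = y₀ + ∫ r in (0 : ℝ)..t, F r (y r)) ∧
      ∀ t ∈ Icc 0 s, ‖y t - ξ t‖ ≤ 2 * Real.exp (2 * L * s) * e := by
  have he : 0 ≤ e := (norm_nonneg _).trans (hdef 0 ⟨le_rfl, hs⟩)
  -- Curves are stored with the weight `exp (-2 L t)`, for which the Picard map contracts.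
  let X : C(Icc (0 : ℝ) s, E) → ℝ → E := fun w t => Real.exp (2 * L * t) • w (projIcc 0 s hs t)
  have hX : ∀ w, Continuous (X w) := fun w => by
    have : Continuous fun t => w (projIcc 0 s hs t) := w.continuous.comp continuous_projIcc
    fun_prop
  let Y : C(Icc (0 : ℝ) s, E) → ℝ → E := fun w t => y₀ + ∫ r in (0 : ℝ)..t, F r (X w r)
  have hY : ∀ w, ContinuousOn (Y w) (Icc 0 s) := fun w => by
    refine continuousOn_const.add ?_
    have := intervalIntegral.continuousOn_primitive_interval' (hint _ (hX w)) left_mem_uIcc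
    rwa [uIcc_of_le hs] at this
  have hsub : ∀ w, ∀ t ∈ Icc 0 s, IntervalIntegrable (fun r => F r (X w r)) volume 0 t :=
    fun w t ht => (hint _ (hX w)).mono_set (by
      rw [uIcc_of_le hs, uIcc_of_le ht.1]; exact Icc_subset_Icc_right ht.2)
  let P : C(Icc (0 : ℝ) s, E) → C(Icc (0 : ℝ) s, E) := fun w =>
    ⟨fun t => Real.exp (-(2 * L * t)) • Y w t, by
      have h2 : Continuous fun t : Icc (0 : ℝ) s => Y w t :=
        continuousOn_iff_continuous_domRestrict.1 (hY w)
      exact Continuous.smul (by fun_prop) h2⟩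
  have hP : ∀ w w', dist (P w) (P w') ≤ (1 / 2 : ℝ) * dist w w' := by
    intro w w'
    rw [ContinuousMap.dist_le (by positivity)]
    rintro ⟨t, ht⟩
    have hD : (0 : ℝ) ≤ dist w w' := dist_nonneg
    have hI : ‖Y w t - Y w' t‖ ≤ dist w w' * ((Real.exp (2 * L * t) - 1) / 2) := by
      have h1 : Y w t - Y w' t = ∫ r in (0 : ℝ)..t, (F r (X w r) - F r (X w' r)) := by
        rw [intervalIntegral.integral_sub (hsub w t ht) (hsub w' t ht)]
        simp only [Y]; abel
      have h2 : ∫ r in (0 : ℝ)..t, L * dist w w' * Real.exp (2 * L * r)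
          = dist w w' * ((Real.exp (2 * L * t) - 1) / 2) := by
        rw [intervalIntegral.integral_const_mul,
          intervalIntegral.integral_comp_mul_left (fun r => Real.exp r) (by positivity),
          integral_exp]
        simp only [mul_zero, Real.exp_zero, smul_eq_mul]
        field_simp
      rw [h1, ← h2]
      refine intervalIntegral.norm_integral_le_of_norm_le ht.1 ?_
        (Continuous.intervalIntegrable (by fun_prop) _ _)
      refine Eventually.of_forall fun r hr => ?_
      have hr' : r ∈ Icc 0 s := ⟨hr.1.le, hr.2.trans ht.2⟩
      refine (hF r hr' _ _).trans ?_
      have h3 : ‖X w r - X w' r‖ ≤ Real.exp (2 * L * r) * dist w w' := by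
        simp only [X]
        rw [← smul_sub, norm_smul, Real.norm_of_nonneg (Real.exp_pos _).le, ← dist_eq_norm]
        gcongr
        exact ContinuousMap.dist_apply_le_dist _
      calc L * ‖X w r - X w' r‖ ≤ L * (Real.exp (2 * L * r) * dist w w') := by gcongr
        _ = _ := by ring
    change dist (Real.exp (-(2 * L * t)) • Y w t) (Real.exp (-(2 * L * t)) • Y w' t) ≤ _
    rw [dist_eq_norm, ← smul_sub, norm_smul, Real.norm_of_nonneg (Real.exp_pos _).le]
    calc Real.exp (-(2 * L * t)) * ‖Y w t - Y w' t‖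
        ≤ Real.exp (-(2 * L * t)) * (dist w w' * (Real.exp (2 * L * t) / 2)) := by
          gcongr
          refine hI.trans ?_
          gcongr
          linarith
      _ = Real.exp (-(2 * L * t)) * Real.exp (2 * L * t) * (1 / 2 * dist w w') := by ring
      _ = 1 / 2 * dist w w' := by rw [← Real.exp_add]; simp
  have hc : ContractingWith (1 / 2) P :=
    ⟨by rw [← NNReal.coe_lt_coe]; norm_num, LipschitzWith.of_dist_le_mul fun w w' => by
      simpa using hP w w'⟩
  set w := ContractingWith.fixedPoint P hc with hw
  have hfix : ∀ t (ht : t ∈ Icc 0 s), X w t = Y w t := by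
    intro t ht
    have h1 : P w = w := hc.fixedPoint_isFixedPt
    have h2 : w ⟨t, ht⟩ = Real.exp (-(2 * L * t)) • Y w t := by
      conv_lhs => rw [← h1]
      rfl
    simp only [X]
    rw [projIcc_of_mem hs ht, h2, smul_smul, ← Real.exp_add]
    simp
  refine ⟨X w, hX w, hfix, fun t ht => ?_⟩
  let w₀ : C(Icc (0 : ℝ) s, E) := ⟨fun t => Real.exp (-(2 * L * t)) • ξ t, by fun_prop⟩
  have hX₀ : ∀ r ∈ Icc 0 s, X w₀ r = ξ r := by
    intro r hr
    simp only [X]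
    rw [projIcc_of_mem hs hr]
    change Real.exp (2 * L * r) • (Real.exp (-(2 * L * r)) • ξ r) = _
    rw [smul_smul, ← Real.exp_add]
    simp
  have hd₀ : dist w₀ (P w₀) ≤ e := by
    rw [ContinuousMap.dist_le he]
    rintro ⟨r, hr⟩
    change dist (Real.exp (-(2 * L * r)) • ξ r) (Real.exp (-(2 * L * r)) • Y w₀ r) ≤ _
    rw [dist_eq_norm', ← smul_sub, norm_smul, Real.norm_of_nonneg (Real.exp_pos _).le]
    have h1 : Y w₀ r = y₀ + ∫ q in (0 : ℝ)..r, F q (ξ q) := by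
      simp only [Y]
      congr 1
      refine intervalIntegral.integral_congr fun q hq => ?_
      rw [uIcc_of_le hr.1] at hq
      simp only [hX₀ q ⟨hq.1, hq.2.trans hr.2⟩]
    rw [h1]
    have h2 : Real.exp (-(2 * L * r)) ≤ 1 := by
      rw [Real.exp_le_one_iff]
      have := mul_nonneg hL.le hr.1
      linarith
    calc _ ≤ 1 * e := by
          gcongr
          exact hdef r hr
      _ = e := one_mul e
  have hd : dist w₀ w ≤ 2 * e := by
    have := hc.dist_fixedPoint_le w₀
    rw [← hw] at this
    refine this.trans ?_
    have h3 : (1 : ℝ) - ((1 / 2 : NNReal) : ℝ) = 1 / 2 := by norm_num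
    rw [h3]
    linarith
  rw [← hX₀ t ht]
  simp only [X]
  rw [← smul_sub, norm_smul, Real.norm_of_nonneg (Real.exp_pos _).le, ← dist_eq_norm, dist_comm]
  calc Real.exp (2 * L * t) * dist (w₀ (projIcc 0 s hs t)) (w (projIcc 0 s hs t))
      ≤ Real.exp (2 * L * s) * (2 * e) := by
        gcongr
        · exact ht.2
        · exact (ContinuousMap.dist_apply_le_dist _).trans hd
    _ = _ := by ring

/-! ### Controlled paths -/

theorem setLIntegral_Icc_comp_add_left (f : ℝ → ℝ≥0∞) (a b : ℝ) :
    ∫⁻ t in Icc 0 (b - a), f (a + t) = ∫⁻ t in Icc a b, f t := by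
  have h := (measurePreserving_add_left (volume : Measure ℝ) a).setLIntegral_comp_preimage_emb
    (measurableEmbedding_addLeft a) f (Icc a b)
  rwa [preimage_const_add_Icc, sub_self] at h

theorem setLIntegral_Icc_add_Icc (f : ℝ → ℝ≥0∞) {a b c : ℝ} (hab : a ≤ b) (hbc : b ≤ c) :
    ∫⁻ t in Icc a c, f t = (∫⁻ t in Icc a b, f t) + ∫⁻ t in Icc b c, f t := by
  rw [← setLIntegral_congr (Ioc_ae_eq_Icc (a := b) (b := c)),
    ← lintegral_union measurableSet_Ioc ?_, Icc_union_Ioc_eq_Icc hab hbc]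
  exact disjoint_left.2 fun t h1 h2 => absurd h1.2 (not_le.2 h2.1)

/-- A continuous function of a continuous state and a bounded measurable control is integrable
over a compact time interval. -/
theorem integrableOn_comp_state_control {E F G : Type*} [NormedAddCommGroup E]
    [NormedSpace ℝ E] [FiniteDimensional ℝ E] [NormedAddCommGroup F] [NormedSpace ℝ F]
    [FiniteDimensional ℝ F] [MeasurableSpace F] [BorelSpace F] [NormedAddCommGroup G]
    {c : E × F → G} (hc : Continuous c) {x : ℝ → E} {u : ℝ → F} {a b C : ℝ}
    (hx : ContinuousOn x (Icc a b)) (hu : Measurable u) (hC : ∀ t ∈ Icc a b, ‖u t‖ ≤ C) :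
    IntegrableOn (fun t => c (x t, u t)) (Icc a b) := by
  have : SecondCountableTopology F := secondCountable_of_proper
  obtain ⟨D, hD⟩ := (((isCompact_Icc.image_of_continuousOn hx).prod
    (isCompact_closedBall (0 : F) C)).exists_bound_of_continuousOn hc.continuousOn)
  refine Integrable.of_bound (C := D) ?_ ?_
  · exact hc.comp_aestronglyMeasurable
      ((hx.aestronglyMeasurable measurableSet_Icc).prodMk hu.aestronglyMeasurable)
  · filter_upwards [ae_restrict_mem measurableSet_Icc] with t ht
    exact hD _ ⟨mem_image_of_mem x ht, by simpa using hC t ht⟩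

namespace MPCProblem

variable {n m : ℕ} {M : MPCProblem n m}

/-- `(x, u)` is a trajectory of `ẋ = A(x) + B(x) u` on `[0, s]` from `x₀` under a bounded
measurable control with values in `U`; there is no terminal constraint. -/
structure IsPath (M : MPCProblem n m) (s : ℝ) (x₀ : EuclideanSpace ℝ (Fin n))
    (x : ℝ → EuclideanSpace ℝ (Fin n)) (u : ℝ → EuclideanSpace ℝ (Fin m)) : Prop where
  measurable_control : Measurable u
  bounded_control : ∃ C : ℝ, ∀ t ∈ Icc 0 s, ‖u t‖ ≤ C
  control_mem : ∀ t ∈ Icc 0 s, u t ∈ M.U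
  continuousOn_state : ContinuousOn x (Icc 0 s)
  state_eq : ∀ t ∈ Icc 0 s, x t = x₀ + ∫ r in (0 : ℝ)..t, M.field (x r) (u r)

/-- The running cost over `[0, s]`. -/
noncomputable def runningCost (M : MPCProblem n m) (s : ℝ) (x : ℝ → EuclideanSpace ℝ (Fin n))
    (u : ℝ → EuclideanSpace ℝ (Fin m)) : ℝ≥0∞ :=
  ∫⁻ t in Icc 0 s, ENNReal.ofReal (M.g (x t) (u t))

theorem isFeasiblePair_iff {x₀ : EuclideanSpace ℝ (Fin n)} {x : ℝ → EuclideanSpace ℝ (Fin n)}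
    {u : ℝ → EuclideanSpace ℝ (Fin m)} :
    M.IsFeasiblePair x₀ x u ↔ M.IsPath M.T x₀ x u ∧ x M.T ∈ M.terminalSet :=
  ⟨fun h => ⟨⟨h.1, h.2, h.3, h.4, h.5⟩, h.6⟩, fun h => ⟨h.1.1, h.1.2, h.1.3, h.1.4, h.1.5, h.2⟩⟩

theorem continuous_field (hA : Continuous M.A) (hB : Continuous M.B) :
    Continuous (Function.uncurry M.field) := by
  unfold field Function.uncurry
  fun_prop

namespace IsPath

variable {s s' τ : ℝ} {x₀ : EuclideanSpace ℝ (Fin n)} {x y : ℝ → EuclideanSpace ℝ (Fin n)}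
  {u v : ℝ → EuclideanSpace ℝ (Fin m)}

theorem state_zero (h : M.IsPath s x₀ x u) (hs : 0 ≤ s) : x 0 = x₀ := by
  simpa using h.state_eq 0 ⟨le_rfl, hs⟩

theorem integrableOn {G : Type*} [NormedAddCommGroup G]
    {c : EuclideanSpace ℝ (Fin n) × EuclideanSpace ℝ (Fin m) → G} (hc : Continuous c)
    (h : M.IsPath s x₀ x u) : IntegrableOn (fun t => c (x t, u t)) (Icc 0 s) := by
  obtain ⟨C, hC⟩ := h.bounded_control
  exact integrableOn_comp_state_control hc h.continuousOn_state h.measurable_control hC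

theorem intervalIntegrable {G : Type*} [NormedAddCommGroup G]
    {c : EuclideanSpace ℝ (Fin n) × EuclideanSpace ℝ (Fin m) → G} (hc : Continuous c)
    (h : M.IsPath s x₀ x u) {a b : ℝ} (ha : a ∈ Icc 0 s) (hb : b ∈ Icc 0 s) :
    IntervalIntegrable (fun t => c (x t, u t)) volume a b := by
  have hs : 0 ≤ s := ha.1.trans ha.2
  have h1 : IntervalIntegrable (fun t => c (x t, u t)) volume 0 s := by
    rw [intervalIntegrable_iff_integrableOn_Icc_of_le hs]
    exact h.integrableOn hc
  exact h1.mono_set (by rw [uIcc_of_le hs]; exact uIcc_subset_Icc ha hb)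

theorem mono (h : M.IsPath s x₀ x u) (hs : s' ≤ s) : M.IsPath s' x₀ x u := by
  have hsub : Icc 0 s' ⊆ Icc 0 s := Icc_subset_Icc_right hs
  obtain ⟨C, hC⟩ := h.bounded_control
  exact ⟨h.1, ⟨C, fun t ht => hC t (hsub ht)⟩, fun t ht => h.3 t (hsub ht),
    h.4.mono hsub, fun t ht => h.5 t (hsub ht)⟩

/-- What remains of a path after time `τ` is a path, on a clock restarted at `τ`. -/
theorem shift (hA : Continuous M.A) (hB : Continuous M.B) (h : M.IsPath s x₀ x u)
    (hτ : τ ∈ Icc 0 s) :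
    M.IsPath (s - τ) (x τ) (fun t => x (τ + t)) (fun t => u (τ + t)) := by
  have hmem : ∀ t ∈ Icc 0 (s - τ), τ + t ∈ Icc 0 s := fun t ht =>
    ⟨add_nonneg hτ.1 ht.1, by linarith [ht.2]⟩
  obtain ⟨C, hC⟩ := h.bounded_control
  refine ⟨h.1.comp (measurable_const_add τ), ⟨C, fun t ht => hC _ (hmem t ht)⟩,
    fun t ht => h.3 _ (hmem t ht), h.4.comp (by fun_prop) hmem, fun t ht => ?_⟩
  have hs : (0 : ℝ) ∈ Icc 0 s := ⟨le_rfl, hτ.1.trans hτ.2⟩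
  have hf := continuous_field hA hB
  have h1 := intervalIntegral.integral_comp_add_left (a := 0) (b := t)
    (fun r => M.field (x r) (u r)) τ
  rw [h1, h.5 _ (hmem t ht), h.5 τ hτ, add_zero, add_assoc,
    intervalIntegral.integral_add_adjacent_intervals]
  · exact h.intervalIntegrable hf hs hτ
  · exact h.intervalIntegrable hf hτ (hmem t ht)

theorem runningCost_shift (hτ : τ ∈ Icc 0 s) :
    M.runningCost s x u = M.runningCost τ x u +
      M.runningCost (s - τ) (fun t => x (τ + t)) (fun t => u (τ + t)) := by
  unfold runningCost
  rw [setLIntegral_Icc_comp_add_left (fun t => ENNReal.ofReal (M.g (x t) (u t))),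
    setLIntegral_Icc_add_Icc _ hτ.1 hτ.2]

/-- Paths can be concatenated, and the running costs add up. -/
theorem append (hA : Continuous M.A) (hB : Continuous M.B) (hs : 0 ≤ s) (hs' : 0 ≤ s')
    (h : M.IsPath s x₀ x u) (h' : M.IsPath s' (x s) y v) :
    ∃ z w, M.IsPath (s + s') x₀ z w ∧ z (s + s') = y s' ∧
      M.runningCost (s + s') z w = M.runningCost s x u + M.runningCost s' y v := by
  let z : ℝ → EuclideanSpace ℝ (Fin n) := fun t => if t ≤ s then x t else y (t - s)
  let w : ℝ → EuclideanSpace ℝ (Fin m) := fun t => if t ≤ s then u t else v (t - s)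
  have hy0 : y 0 = x s := h'.state_zero hs'
  have hz1 : ∀ t ∈ Icc 0 s, z t = x t := fun t ht => if_pos ht.2
  have hw1 : ∀ t ∈ Icc 0 s, w t = u t := fun t ht => if_pos ht.2
  have hz2 : ∀ t ∈ Icc s (s + s'), z t = y (t - s) := by
    intro t ht
    rcases ht.1.eq_or_lt with h1 | h1
    · subst h1
      simp [z, hy0]
    · exact if_neg h1.not_ge
  have hw2 : ∀ t ∈ Ioc s (s + s'), w t = v (t - s) := fun t ht => if_neg ht.1.not_ge
  have hmem : ∀ t ∈ Icc s (s + s'), t - s ∈ Icc 0 s' := fun t ht =>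
    ⟨by linarith [ht.1], by linarith [ht.2]⟩
  have hcases : ∀ t ∈ Icc 0 (s + s'), t ∈ Icc 0 s ∨ t ∈ Ioc s (s + s') := by
    intro t ht
    rcases le_or_gt t s with h1 | h1
    · exact Or.inl ⟨ht.1, h1⟩
    · exact Or.inr ⟨h1, ht.2⟩
  have hwm : Measurable w := Measurable.ite measurableSet_Iic h.1
    (h'.1.comp (measurable_id.sub_const s))
  have hwb : ∃ C : ℝ, ∀ t ∈ Icc 0 (s + s'), ‖w t‖ ≤ C := by
    obtain ⟨C, hC⟩ := h.bounded_control
    obtain ⟨C', hC'⟩ := h'.bounded_control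
    refine ⟨max C C', fun t ht => ?_⟩
    rcases hcases t ht with h1 | h1
    · rw [hw1 t h1]
      exact (hC t h1).trans (le_max_left _ _)
    · rw [hw2 t h1]
      exact (hC' _ (hmem t (Ioc_subset_Icc_self h1))).trans (le_max_right _ _)
  have hzc : ContinuousOn z (Icc 0 (s + s')) := by
    rw [← Icc_union_Icc_eq_Icc hs (le_add_of_nonneg_right hs')]
    refine ContinuousOn.union_of_isClosed (h.4.congr hz1) ?_ isClosed_Icc isClosed_Icc
    exact (h'.4.comp (by fun_prop) hmem).congr hz2
  have hf := continuous_field hA hB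
  obtain ⟨C, hC⟩ := hwb
  have hint : IntegrableOn (fun t => M.field (z t) (w t)) (Icc 0 (s + s')) :=
    integrableOn_comp_state_control hf hzc hwm hC
  have hx : ∀ t ∈ Icc 0 s,
      ∫ r in (0 : ℝ)..t, M.field (z r) (w r) = ∫ r in (0 : ℝ)..t, M.field (x r) (u r) := by
    intro t ht
    refine intervalIntegral.integral_congr fun r hr => ?_
    rw [uIcc_of_le ht.1] at hr
    have hr' : r ∈ Icc 0 s := ⟨hr.1, hr.2.trans ht.2⟩
    simp only [hz1 r hr', hw1 r hr']
  refine ⟨z, w, ⟨hwm, ⟨C, hC⟩, ?_, hzc, ?_⟩, ?_, ?_⟩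
  · intro t ht
    rcases hcases t ht with h1 | h1
    · rw [hw1 t h1]
      exact h.3 t h1
    · rw [hw2 t h1]
      exact h'.3 _ (hmem t (Ioc_subset_Icc_self h1))
  · intro t ht
    rcases hcases t ht with h1 | h1
    · rw [hz1 t h1, hx t h1, h.5 t h1]
    · have h2 := Ioc_subset_Icc_self h1
      have h3 : ∫ r in s..t, M.field (z r) (w r)
          = ∫ r in (0 : ℝ)..(t - s), M.field (y r) (v r) := by
        have h4 := intervalIntegral.integral_comp_sub_right (a := s) (b := t)
          (fun r => M.field (y r) (v r)) s
        rw [sub_self] at h4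
        rw [← h4]
        refine intervalIntegral.integral_congr_ae (Eventually.of_forall fun r hr => ?_)
        rw [uIoc_of_le h1.1.le] at hr
        have hr' : r ∈ Ioc s (s + s') := ⟨hr.1, hr.2.trans h1.2⟩
        simp only [hz2 r (Ioc_subset_Icc_self hr'), hw2 r hr']
      have hsub : ∀ a b, a ∈ Icc 0 (s + s') → b ∈ Icc 0 (s + s') →
          IntervalIntegrable (fun r => M.field (z r) (w r)) volume a b := fun a b ha hb =>
        (hint.mono_set (uIcc_subset_Icc ha hb)).intervalIntegrable
      rw [← intervalIntegral.integral_add_adjacent_intervals (b := s)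
        (hsub _ _ ⟨le_rfl, by linarith⟩ ⟨hs, by linarith⟩)
        (hsub _ _ ⟨hs, by linarith⟩ ht), hx s ⟨hs, le_rfl⟩, h3, ← add_assoc,
        ← h.5 s ⟨hs, le_rfl⟩, hz2 t h2, h'.5 _ (hmem t h2)]
  · rw [hz2 _ ⟨by linarith, le_rfl⟩, add_sub_cancel_left]
  · unfold runningCost
    rw [setLIntegral_Icc_add_Icc _ hs (le_add_of_nonneg_right hs')]
    congr 1
    · refine setLIntegral_congr_fun measurableSet_Icc fun t ht => ?_
      simp only [hz1 t ht, hw1 t ht]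
    · rw [← setLIntegral_Icc_comp_add_left, add_sub_cancel_left,
        ← setLIntegral_congr (Ioc_ae_eq_Icc (a := (0 : ℝ)) (b := s')),
        ← setLIntegral_congr (Ioc_ae_eq_Icc (a := (0 : ℝ)) (b := s'))]
      refine setLIntegral_congr_fun measurableSet_Ioc fun t ht => ?_
      have ht' : s + t ∈ Ioc s (s + s') := ⟨by linarith [ht.1], by linarith [ht.2]⟩
      simp only [hz2 _ (Ioc_subset_Icc_self ht'), hw2 _ ht', add_sub_cancel_left]

end IsPath

end MPCProblem

/-! ### Existence and perturbation of paths -/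

namespace MPCProblem

variable {n m : ℕ} {M : MPCProblem n m}

/-- Near an approximate trajectory `ξ` with values in a ball there is a trajectory with the same
control, with a constant that is uniform in the horizon and in the bounded control. -/
theorem exists_isPath_near (hA : LocallyLipschitz M.A) (hB : LocallyLipschitz M.B) (R C T : ℝ) :
    ∃ L : ℝ, 0 < L ∧ ∀ s : ℝ, 0 ≤ s → s ≤ T → ∀ u : ℝ → EuclideanSpace ℝ (Fin m), Measurable u →
      (∀ t ∈ Icc 0 s, ‖u t‖ ≤ C) → (∀ t ∈ Icc 0 s, u t ∈ M.U) →
      ∀ ξ : ℝ → EuclideanSpace ℝ (Fin n), ContinuousOn ξ (Icc 0 s) →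
      (∀ t ∈ Icc 0 s, ‖ξ t‖ ≤ R) → ∀ (y₀ : EuclideanSpace ℝ (Fin n)) (e : ℝ),
      (∀ t ∈ Icc 0 s, ‖y₀ + (∫ r in (0 : ℝ)..t, M.field (ξ r) (u r)) - ξ t‖ ≤ e) → L * e ≤ 1 →
      ∃ y, Continuous y ∧ M.IsPath s y₀ y u ∧ ∀ t ∈ Icc 0 s, ‖y t - ξ t‖ ≤ L * e := by
  -- `A` and `B` are cut off outside a ball that no trajectory at distance at most `1` leaves.
  have hK : IsCompact (Metric.closedBall (0 : EuclideanSpace ℝ (Fin n)) (R + 1)) :=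
    isCompact_closedBall _ _
  obtain ⟨KA, hKA⟩ := hA.locallyLipschitzOn.exists_lipschitzOnWith_of_compact hK
  obtain ⟨KB, hKB⟩ := hB.locallyLipschitzOn.exists_lipschitzOnWith_of_compact hK
  obtain ⟨A', hA', hAA'⟩ := hKA.extend_finite_dimension
  obtain ⟨B', hB', hBB'⟩ := hKB.extend_finite_dimension
  set a := lipschitzExtensionConstant (EuclideanSpace ℝ (Fin n)) * KA
  set b := lipschitzExtensionConstant
    (EuclideanSpace ℝ (Fin m) →L[ℝ] EuclideanSpace ℝ (Fin n)) * KB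
  have hℓ : (0 : ℝ) < a + b * |C| + 1 := by positivity
  refine ⟨2 * Real.exp (2 * (a + b * |C| + 1) * T), by positivity, ?_⟩
  intro s hs hsT u hu hC hU ξ hξ hR y₀ e hdef he
  have he0 : 0 ≤ e := (norm_nonneg _).trans (hdef 0 ⟨le_rfl, hs⟩)
  let F : ℝ → EuclideanSpace ℝ (Fin n) → EuclideanSpace ℝ (Fin n) := fun t p => A' p + B' p (u t)
  have hFeq : ∀ t p, ‖p‖ ≤ R + 1 → F t p = M.field p (u t) := by
    intro t p hp
    have hp' : p ∈ Metric.closedBall (0 : EuclideanSpace ℝ (Fin n)) (R + 1) := by simpa using hp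
    simp only [F, field]
    rw [hAA' hp', hBB' hp']
  let ξ' : ℝ → EuclideanSpace ℝ (Fin n) := fun t => ξ (projIcc 0 s hs t)
  have hξ' : Continuous ξ' := hξ.comp_continuous
    (continuous_subtype_val.comp continuous_projIcc) fun t => (projIcc 0 s hs t).2
  have hξξ' : ∀ t ∈ Icc 0 s, ξ' t = ξ t := fun t ht => by simp only [ξ', projIcc_of_mem hs ht]
  have hlip : ∀ t ∈ Icc 0 s, ∀ p q, ‖F t p - F t q‖ ≤ (a + b * |C| + 1) * ‖p - q‖ := by
    intro t ht p q
    have h1 : ‖A' p - A' q‖ ≤ a * ‖p - q‖ := hA'.norm_sub_le p q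
    have h2 : ‖B' p (u t) - B' q (u t)‖ ≤ b * ‖p - q‖ * |C| := by
      rw [← sub_apply]
      refine (ContinuousLinearMap.le_opNorm _ _).trans ?_
      gcongr
      · exact hB'.norm_sub_le p q
      · exact (hC t ht).trans (le_abs_self C)
    calc ‖F t p - F t q‖ = ‖(A' p - A' q) + (B' p (u t) - B' q (u t))‖ := by
          simp only [F]; congr 1; abel
      _ ≤ a * ‖p - q‖ + b * ‖p - q‖ * |C| := (norm_add_le _ _).trans (add_le_add h1 h2)
      _ ≤ (a + b * |C| + 1) * ‖p - q‖ := by nlinarith [norm_nonneg (p - q)]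
  have hint : ∀ x : ℝ → EuclideanSpace ℝ (Fin n), Continuous x →
      IntervalIntegrable (fun t => F t (x t)) volume 0 s := by
    intro x hx
    rw [intervalIntegrable_iff_integrableOn_Icc_of_le hs]
    have hc : Continuous fun p : EuclideanSpace ℝ (Fin n) × EuclideanSpace ℝ (Fin m) =>
        A' p.1 + B' p.1 p.2 := by
      have := hA'.continuous
      have := hB'.continuous
      fun_prop
    exact integrableOn_comp_state_control hc hx.continuousOn hu hC
  have hdef' : ∀ t ∈ Icc 0 s, ‖y₀ + (∫ r in (0 : ℝ)..t, F r (ξ' r)) - ξ' t‖ ≤ e := by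
    intro t ht
    rw [hξξ' t ht]
    refine le_of_eq_of_le ?_ (hdef t ht)
    congr 3
    refine intervalIntegral.integral_congr fun r hr => ?_
    rw [uIcc_of_le ht.1] at hr
    have hr' : r ∈ Icc 0 s := ⟨hr.1, hr.2.trans ht.2⟩
    simp only [hξξ' r hr']
    exact hFeq r _ ((hR r hr').trans (by linarith))
  obtain ⟨y, hyc, hy, hyξ⟩ := exists_integral_solution_near hs hℓ hlip hint hξ' y₀ hdef'
  have hyξ' : ∀ t ∈ Icc 0 s,
      ‖y t - ξ t‖ ≤ 2 * Real.exp (2 * (a + b * |C| + 1) * T) * e := by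
    intro t ht
    rw [← hξξ' t ht]
    refine (hyξ t ht).trans ?_
    gcongr
  have hyR : ∀ t ∈ Icc 0 s, ‖y t‖ ≤ R + 1 := by
    intro t ht
    have h1 : ‖y t‖ ≤ ‖ξ t‖ + ‖y t - ξ t‖ := norm_le_norm_add_norm_sub' _ _
    linarith [hR t ht, hyξ' t ht]
  refine ⟨y, hyc, ⟨hu, ⟨C, hC⟩, hU, hyc.continuousOn, fun t ht => ?_⟩, hyξ'⟩
  rw [hy t ht]
  congr 1
  refine intervalIntegral.integral_congr fun r hr => ?_
  rw [uIcc_of_le ht.1] at hr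
  exact hFeq r _ (hyR r ⟨hr.1, hr.2.trans ht.2⟩)

/-- Lipschitz dependence on the initial state, uniform in the time `τ` at which a given path is
left. -/
theorem IsPath.exists_perturbed {s : ℝ} {x₀ : EuclideanSpace ℝ (Fin n)}
    {x : ℝ → EuclideanSpace ℝ (Fin n)} {u : ℝ → EuclideanSpace ℝ (Fin m)}
    (hA : LocallyLipschitz M.A) (hB : LocallyLipschitz M.B) (h : M.IsPath s x₀ x u) :
    ∃ L : ℝ, 0 < L ∧ ∀ τ ∈ Icc 0 s, ∀ y₀, L * ‖y₀ - x τ‖ ≤ 1 →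
      ∃ y, M.IsPath (s - τ) y₀ y (fun t => u (τ + t)) ∧
        ∀ t ∈ Icc 0 (s - τ), ‖y t - x (τ + t)‖ ≤ L * ‖y₀ - x τ‖ := by
  obtain ⟨R, hR⟩ := isCompact_Icc.exists_bound_of_continuousOn h.continuousOn_state
  obtain ⟨C, hC⟩ := h.bounded_control
  obtain ⟨L, hL, hnear⟩ := exists_isPath_near hA hB R C s
  refine ⟨L, hL, fun τ hτ y₀ hy₀ => ?_⟩
  have hmem : ∀ t ∈ Icc 0 (s - τ), τ + t ∈ Icc 0 s := fun t ht =>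
    ⟨add_nonneg hτ.1 ht.1, by linarith [ht.2]⟩
  have hsh := h.shift hA.continuous hB.continuous hτ
  have hdef : ∀ t ∈ Icc 0 (s - τ),
      ‖y₀ + (∫ r in (0 : ℝ)..t, M.field (x (τ + r)) (u (τ + r))) - x (τ + t)‖ ≤ ‖y₀ - x τ‖ := by
    intro t ht
    rw [hsh.5 t ht]
    exact le_of_eq (by congr 1; abel)
  obtain ⟨y, -, hy, hyx⟩ := hnear (s - τ) (by linarith [hτ.2]) (by linarith [hτ.1]) _ hsh.1
    (fun t ht => hC _ (hmem t ht)) hsh.3 _ hsh.4 (fun t ht => hR _ (hmem t ht)) y₀ ‖y₀ - x τ‖ hdef hy₀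
  exact ⟨y, hy, hyx⟩

/-- Short paths with a constant control exist from all states near a given one, for a uniform
time, and remain nearby. -/
theorem exists_isPath_const (hA : LocallyLipschitz M.A) (hB : LocallyLipschitz M.B)
    (z : EuclideanSpace ℝ (Fin n)) {v : EuclideanSpace ℝ (Fin m)} (hv : v ∈ M.U) {ε : ℝ}
    (hε : 0 < ε) :
    ∃ r > 0, ∃ δ > 0, ∀ q ∈ Metric.ball z r, ∀ h ∈ Icc 0 δ,
      ∃ k, Continuous k ∧ M.IsPath h q k (fun _ => v) ∧ ∀ t ∈ Icc 0 h, k t ∈ Metric.ball z ε := by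
  obtain ⟨L, hL, hnear⟩ := exists_isPath_near hA hB ‖z‖ ‖v‖ 1
  set e := min 1 (ε / 2) / L with he
  have he0 : 0 < e := by positivity
  have hLe : L * e = min 1 (ε / 2) := by rw [he]; field_simp
  have hN : 0 < ‖M.field z v‖ + 1 := by positivity
  refine ⟨e / 2, by positivity, min 1 (e / 2 / (‖M.field z v‖ + 1)), by positivity, ?_⟩
  intro q hq h hh
  have hdef : ∀ t ∈ Icc 0 h, ‖q + (∫ _ in (0 : ℝ)..t, M.field z v) - z‖ ≤ e := by
    intro t ht
    rw [intervalIntegral.integral_const, sub_zero]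
    rw [mem_ball_iff_norm] at hq
    have h1 : ‖t • M.field z v‖ ≤ e / 2 := by
      rw [norm_smul, Real.norm_of_nonneg ht.1]
      have h2 : t ≤ e / 2 / (‖M.field z v‖ + 1) := (ht.2.trans hh.2).trans (min_le_right _ _)
      rw [le_div_iff₀ hN] at h2
      nlinarith [ht.1]
    calc ‖q + t • M.field z v - z‖ = ‖(q - z) + t • M.field z v‖ := by congr 1; abel
      _ ≤ ‖q - z‖ + ‖t • M.field z v‖ := norm_add_le _ _
      _ ≤ e := by linarith
  obtain ⟨k, hkc, hk, hkz⟩ := hnear h hh.1 (hh.2.trans (min_le_left _ _)) (fun _ => v)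
    measurable_const (fun _ _ => le_rfl) (fun _ _ => hv) (fun _ => z) continuousOn_const
    (fun _ _ => le_rfl) q e hdef (hLe.trans_le (min_le_left _ _))
  refine ⟨k, hkc, hk, fun t ht => ?_⟩
  rw [mem_ball_iff_norm]
  have h1 := hkz t ht
  rw [hLe] at h1
  exact (h1.trans (min_le_right _ _)).trans_lt (by linarith)

theorem IsPath.runningCost_eq {s : ℝ} {x₀ : EuclideanSpace ℝ (Fin n)}
    {x : ℝ → EuclideanSpace ℝ (Fin n)} {u : ℝ → EuclideanSpace ℝ (Fin m)}
    (hg : Continuous (Function.uncurry M.g)) (hg0 : ∀ x u, 0 ≤ M.g x u)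
    (hs : 0 ≤ s) (h : M.IsPath s x₀ x u) :
    M.runningCost s x u = ENNReal.ofReal (∫ t in (0 : ℝ)..s, M.g (x t) (u t)) := by
  rw [intervalIntegral.integral_of_le hs, ← integral_Icc_eq_integral_Ioc,
    ofReal_integral_eq_lintegral_ofReal (f := fun t => M.g (x t) (u t)) (h.integrableOn hg)
      (Eventually.of_forall fun t => hg0 _ _)]
  rfl

/-- If `v` satisfies the terminal inequality at `z`, then from every state near `z` the constant
control `v` pays, up to an error `η h`, its running cost over a short time `h` by a decrease of the
terminal cost. -/
theorem exists_isPath_descent (hA : LocallyLipschitz M.A) (hB : LocallyLipschitz M.B)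
    (hg : Continuous (Function.uncurry M.g)) (hg0 : ∀ x u, 0 ≤ M.g x u)
    (hΦ : ContDiff ℝ 1 M.Φ) (hΦ0 : ∀ x, 0 ≤ M.Φ x)
    {z : EuclideanSpace ℝ (Fin n)} {v : EuclideanSpace ℝ (Fin m)} (hv : v ∈ M.U)
    (hzv : fderiv ℝ M.Φ z (M.field z v) + M.g z v ≤ 0) {η : ℝ} (hη : 0 < η) :
    ∃ r > 0, ∃ δ > 0, ∀ q ∈ Metric.ball z r, ∀ h ∈ Icc 0 δ, ∃ k u, M.IsPath h q k u ∧
      M.runningCost h k u + ENNReal.ofReal (M.Φ (k h)) ≤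
        ENNReal.ofReal (M.Φ q) + ENNReal.ofReal (η * h) ∧
      M.Φ (k h) ≤ M.Φ q - h * (M.g z v - η) := by
  have hf : Continuous fun p => M.field p v :=
    (continuous_field hA.continuous hB.continuous).comp (by fun_prop : Continuous fun p => (p, v))
  have hgv : Continuous fun p => M.g p v := hg.comp (by fun_prop : Continuous fun p => (p, v))
  let D : EuclideanSpace ℝ (Fin n) → ℝ := fun p => fderiv ℝ M.Φ p (M.field p v)
  have hD : Continuous D := (hΦ.continuous_fderiv one_ne_zero).clm_apply hf
  have hev : ∀ᶠ p in 𝓝 z, D p + M.g p v < η ∧ D p < -M.g z v + η := by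
    have h1 : D z + M.g z v < η := hzv.trans_lt hη
    exact ((hD.add hgv).continuousAt.eventually_lt continuousAt_const h1).and
      (hD.continuousAt.eventually_lt continuousAt_const (by linarith))
  obtain ⟨ε, hε, hball⟩ := Metric.eventually_nhds_iff_ball.1 hev
  obtain ⟨r, hr, δ, hδ, hpath⟩ := exists_isPath_const hA hB z hv hε
  refine ⟨r, hr, δ, hδ, fun q hq h hh => ?_⟩
  obtain ⟨k, hkc, hk, hkz⟩ := hpath q hq h hh
  have hk0 : k 0 = q := hk.state_zero hh.1
  have hint : (∫ t in (0 : ℝ)..h, D (k t)) = M.Φ (k h) - M.Φ q := by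
    -- `k` agrees on `[0, h]` with a curve that is differentiable everywhere.
    let k' : ℝ → EuclideanSpace ℝ (Fin n) := fun t => q + ∫ r in (0 : ℝ)..t, M.field (k r) v
    have hkk' : ∀ t ∈ Icc 0 h, k' t = k t := fun t ht => (hk.state_eq t ht).symm
    have hk' : ∀ t, HasDerivAt k' (M.field (k t) v) t := fun t =>
      (((hf.comp hkc).integral_hasStrictDerivAt 0 t).hasDerivAt).const_add q
    have h1 : ∀ t ∈ uIcc 0 h, HasDerivAt (fun t => M.Φ (k' t)) (D (k t)) t := by
      intro t ht
      rw [uIcc_of_le hh.1] at ht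
      have h2 := ((hΦ.differentiable one_ne_zero (k' t)).hasFDerivAt).comp_hasDerivAt t (hk' t)
      rwa [hkk' t ht] at h2
    rw [intervalIntegral.integral_eq_sub_of_hasDerivAt h1 ((hD.comp hkc).intervalIntegrable _ _),
      hkk' h ⟨hh.1, le_rfl⟩, hkk' 0 ⟨le_rfl, hh.1⟩, hk0]
  have hDi : IntervalIntegrable (fun t => D (k t)) volume 0 h :=
    (hD.comp hkc).intervalIntegrable _ _
  have hgi : IntervalIntegrable (fun t => M.g (k t) v) volume 0 h :=
    (hgv.comp hkc).intervalIntegrable _ _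
  refine ⟨k, fun _ => v, hk, ?_, ?_⟩
  · rw [hk.runningCost_eq hg hg0 hh.1, ← ENNReal.ofReal_add
      (intervalIntegral.integral_nonneg hh.1 fun t _ => hg0 _ _) (hΦ0 _),
      ← ENNReal.ofReal_add (hΦ0 _) (mul_nonneg hη.le hh.1)]
    refine ENNReal.ofReal_le_ofReal ?_
    have h1 : ∫ t in (0 : ℝ)..h, (D (k t) + M.g (k t) v) ≤ ∫ _ in (0 : ℝ)..h, η :=
      intervalIntegral.integral_mono_on hh.1 (hDi.add hgi) (by simp)
        fun t ht => (hball _ (hkz t ht)).1.le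
    rw [intervalIntegral.integral_add hDi hgi, hint, intervalIntegral.integral_const,
      smul_eq_mul] at h1
    linarith
  · have h1 : ∫ t in (0 : ℝ)..h, D (k t) ≤ ∫ _ in (0 : ℝ)..h, (-M.g z v + η) :=
      intervalIntegral.integral_mono_on hh.1 hDi (by simp) fun t ht => (hball _ (hkz t ht)).2.le
    rw [hint, intervalIntegral.integral_const, smul_eq_mul] at h1
    linarith

/-! ### The terminal set and recursive feasibility -/

theorem g_nonneg [Nontrivial (EuclideanSpace ℝ (Fin n) × EuclideanSpace ℝ (Fin m))]
    (hg : Continuous (Function.uncurry M.g)) (hgpos : ∀ x u, (x, u) ≠ 0 → 0 < M.g x u)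
    (x : EuclideanSpace ℝ (Fin n)) (u : EuclideanSpace ℝ (Fin m)) : 0 ≤ M.g x u := by
  have : NeBot (𝓝[≠] (0 : EuclideanSpace ℝ (Fin n) × EuclideanSpace ℝ (Fin m))) :=
    Module.punctured_nhds_neBot ℝ _ 0
  have hd := dense_compl_singleton (0 : EuclideanSpace ℝ (Fin n) × EuclideanSpace ℝ (Fin m))
  have hcl : IsClosed {p | 0 ≤ Function.uncurry M.g p} := isClosed_le continuous_const hg
  exact closure_minimal (fun p hp => (hgpos p.1 p.2 hp).le) hcl (hd (x, u))

/-- States near a point `z` of the terminal set, and outside the terminal set by at most `ρ h` in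
terms of `Φ`, can be steered into it within time `h` at a total cost of `Φ` plus a small error.
On the boundary this is where strict positivity of the running cost enters: it makes `Φ` decrease
at a positive rate. -/
theorem exists_isPath_terminal_near (hA : LocallyLipschitz M.A) (hB : LocallyLipschitz M.B)
    (hg : Continuous (Function.uncurry M.g)) (hg0 : ∀ x u, 0 ≤ M.g x u)
    (hgpos : ∀ x u, (x, u) ≠ 0 → 0 < M.g x u) (hΦ : ContDiff ℝ 1 M.Φ) (hΦ0 : ∀ x, 0 ≤ M.Φ x)
    (hΦz : M.Φ 0 = 0) (hκ : 0 < M.κ) (hineq : M.TerminalInequality)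
    {z : EuclideanSpace ℝ (Fin n)} (hz : z ∈ M.terminalSet) {η : ℝ} (hη : 0 < η) :
    ∃ r > 0, ∃ δ > 0, ∃ ρ > 0, ∀ q ∈ Metric.ball z r, ∀ h ∈ Icc 0 δ, M.Φ q ≤ M.κ + ρ * h →
      ∃ k u, M.IsPath h q k u ∧ k h ∈ M.terminalSet ∧
        M.runningCost h k u + ENNReal.ofReal (M.Φ (k h)) ≤
          ENNReal.ofReal (M.Φ q) + ENNReal.ofReal (η * h) := by
  obtain ⟨v, hv, hzv⟩ := hineq z hz
  rcases (show M.Φ z ≤ M.κ from hz).lt_or_eq with hlt | heq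
  · obtain ⟨r, hr, δ, hδ, hpath⟩ := exists_isPath_descent hA hB hg hg0 hΦ hΦ0 hv hzv hη
    have hev : ∀ᶠ q in 𝓝 z, M.Φ q < (M.Φ z + M.κ) / 2 :=
      hΦ.continuous.continuousAt.eventually_lt continuousAt_const (by linarith)
    obtain ⟨r', hr', hball⟩ := Metric.eventually_nhds_iff_ball.1 hev
    refine ⟨min r r', lt_min hr hr', min δ ((M.κ - M.Φ z) / 2 / η),
      lt_min hδ (by have := sub_pos.2 hlt; positivity), 1, one_pos, fun q hq h hh _ => ?_⟩
    obtain ⟨k, u, hk, hcost, hdec⟩ := hpath q (Metric.ball_subset_ball (min_le_left _ _) hq) h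
      ⟨hh.1, hh.2.trans (min_le_left _ _)⟩
    refine ⟨k, u, hk, ?_, hcost⟩
    have h1 := hball q (Metric.ball_subset_ball (min_le_right _ _) hq)
    have h2 := (le_div_iff₀ hη).1 (hh.2.trans (min_le_right _ _))
    have h3 := mul_nonneg hh.1 (hg0 z v)
    change M.Φ (k h) ≤ M.κ
    nlinarith
  · have hz0 : z ≠ 0 := by
      rintro rfl
      linarith
    have hgz : 0 < M.g z v := hgpos z v fun h => hz0 (congrArg Prod.fst h)
    obtain ⟨r, hr, δ, hδ, hpath⟩ := exists_isPath_descent hA hB hg hg0 hΦ hΦ0 hv hzv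
      (lt_min hη (half_pos hgz))
    refine ⟨r, hr, δ, hδ, M.g z v / 2, half_pos hgz, fun q hq h hh hΦq => ?_⟩
    obtain ⟨k, u, hk, hcost, hdec⟩ := hpath q hq h hh
    refine ⟨k, u, hk, ?_, hcost.trans ?_⟩
    · have h1 := mul_le_mul_of_nonneg_left (min_le_right η (M.g z v / 2)) hh.1
      change M.Φ (k h) ≤ M.κ
      nlinarith
    · gcongr
      · exact hh.1
      · exact min_le_left _ _

/-- The terminal set is viable: by compactness the time steps of `exists_isPath_terminal_near` can
be chosen uniformly, and finitely many of them cover any length of time. -/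
theorem exists_isPath_terminal (hA : LocallyLipschitz M.A) (hB : LocallyLipschitz M.B)
    (hg : Continuous (Function.uncurry M.g)) (hg0 : ∀ x u, 0 ≤ M.g x u)
    (hgpos : ∀ x u, (x, u) ≠ 0 → 0 < M.g x u) (hΦ : ContDiff ℝ 1 M.Φ) (hΦ0 : ∀ x, 0 ≤ M.Φ x)
    (hΦz : M.Φ 0 = 0) (hκ : 0 < M.κ) (hP : Bornology.IsBounded M.terminalSet)
    (hineq : M.TerminalInequality) {s : ℝ} (hs : 0 ≤ s) {z : EuclideanSpace ℝ (Fin n)}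
    (hz : z ∈ M.terminalSet) : ∃ x u, M.IsPath s z x u ∧ x s ∈ M.terminalSet := by
  have hclosed : IsClosed M.terminalSet := isClosed_le hΦ.continuous continuous_const
  have hcomp : IsCompact M.terminalSet := Metric.isCompact_of_isClosed_isBounded hclosed hP
  obtain ⟨δ, hδ, hstep⟩ : ∃ δ > 0, ∀ q ∈ M.terminalSet, q ∈ M.terminalSet → ∀ h ∈ Icc 0 δ,
      ∃ k u, M.IsPath h q k u ∧ k h ∈ M.terminalSet := by
    refine hcomp.induction_on (p := fun S => ∃ δ > 0, ∀ q ∈ S, q ∈ M.terminalSet → ∀ h ∈ Icc 0 δ,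
      ∃ k u, M.IsPath h q k u ∧ k h ∈ M.terminalSet) ⟨1, one_pos, by simp⟩ ?_ ?_ ?_
    · rintro S S' hSS' ⟨δ, hδ, h⟩
      exact ⟨δ, hδ, fun q hq => h q (hSS' hq)⟩
    · rintro S S' ⟨δ, hδ, h⟩ ⟨δ', hδ', h'⟩
      refine ⟨min δ δ', lt_min hδ hδ', ?_⟩
      rintro q (hq | hq) hqP t ht
      · exact h q hq hqP t ⟨ht.1, ht.2.trans (min_le_left _ _)⟩
      · exact h' q hq hqP t ⟨ht.1, ht.2.trans (min_le_right _ _)⟩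
    · intro z hz
      obtain ⟨r, hr, δ, hδ, ρ, hρ, hpath⟩ := exists_isPath_terminal_near hA hB hg hg0 hgpos hΦ hΦ0
        hΦz hκ hineq hz one_pos
      refine ⟨Metric.ball z r, mem_nhdsWithin_of_mem_nhds (Metric.ball_mem_nhds z hr), δ, hδ, ?_⟩
      intro q hq hqP h hh
      obtain ⟨k, u, hk, hkP, -⟩ := hpath q hq h hh
        ((show M.Φ q ≤ M.κ from hqP).trans (le_add_of_nonneg_right (mul_nonneg hρ.le hh.1)))
      exact ⟨k, u, hk, hkP⟩
  obtain ⟨N, hN⟩ := exists_nat_gt (s / δ)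
  have hN0 : (0 : ℝ) < N := (div_nonneg hs hδ.le).trans_lt hN
  have hh : s / N ∈ Icc 0 δ := by
    refine ⟨by positivity, ?_⟩
    rw [div_lt_iff₀ hδ] at hN
    rw [div_le_iff₀ hN0]
    linarith
  have hiter : ∀ j : ℕ, ∃ x u, M.IsPath ((j + 1 : ℕ) * (s / N)) z x u ∧
      x ((j + 1 : ℕ) * (s / N)) ∈ M.terminalSet := by
    intro j
    induction j with
    | zero => simpa using hstep z hz hz _ hh
    | succ j ih =>
      obtain ⟨x, u, hx, hxP⟩ := ih
      obtain ⟨y, v, hy, hyP⟩ := hstep _ hxP hxP _ hh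
      obtain ⟨w, ω, hw, hwe, -⟩ := hx.append hA.continuous hB.continuous
        (mul_nonneg (Nat.cast_nonneg _) hh.1) hh.1 hy
      have hadd : ((j + 1 + 1 : ℕ) : ℝ) * (s / N) = (j + 1 : ℕ) * (s / N) + s / N := by
        push_cast
        ring
      rw [hadd]
      exact ⟨w, ω, hw, hwe ▸ hyP⟩
  have hNs : (((N - 1 + 1 : ℕ) : ℝ)) * (s / N) = s := by
    rw [Nat.sub_add_cancel (by exact_mod_cast hN0)]
    field_simp
  have := hiter (N - 1)
  rwa [hNs] at this

theorem recursivelyFeasible (hA : LocallyLipschitz M.A) (hB : LocallyLipschitz M.B)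
    (hg : Continuous (Function.uncurry M.g)) (hg0 : ∀ x u, 0 ≤ M.g x u)
    (hgpos : ∀ x u, (x, u) ≠ 0 → 0 < M.g x u) (hΦ : ContDiff ℝ 1 M.Φ) (hΦ0 : ∀ x, 0 ≤ M.Φ x)
    (hΦz : M.Φ 0 = 0) (hκ : 0 < M.κ) (hP : Bornology.IsBounded M.terminalSet)
    (hineq : M.TerminalInequality) : M.RecursivelyFeasible := by
  intro x₀ x u h τ hτ
  obtain ⟨hx, hxT⟩ := isFeasiblePair_iff.1 h
  have hsh := hx.shift hA.continuous hB.continuous hτ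
  obtain ⟨y, v, hy, hyP⟩ := exists_isPath_terminal hA hB hg hg0 hgpos hΦ hΦ0 hΦz hκ hP hineq
    hτ.1 hxT
  obtain ⟨z, w, hz, hze, -⟩ := hsh.append hA.continuous hB.continuous (sub_nonneg.2 hτ.2) hτ.1
    (y := y) (v := v) (by simpa using hy)
  rw [sub_add_cancel] at hz hze
  exact ⟨z, w, isFeasiblePair_iff.2 ⟨hz, hze ▸ hyP⟩⟩

/-! ### Decrease of the value function along curves -/

theorem IsPath.hasDerivWithinAt_integral {s : ℝ} {x₀ : EuclideanSpace ℝ (Fin n)}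
    {x : ℝ → EuclideanSpace ℝ (Fin n)} {u : ℝ → EuclideanSpace ℝ (Fin m)} {G : Type*}
    [NormedAddCommGroup G] [NormedSpace ℝ G] [CompleteSpace G]
    {c : EuclideanSpace ℝ (Fin n) × EuclideanSpace ℝ (Fin m) → G} (hc : Continuous c)
    (hs : 0 < s) (h : M.IsPath s x₀ x u) (hu : ContinuousWithinAt u (Ici 0) 0) :
    HasDerivWithinAt (fun t => ∫ r in (0 : ℝ)..t, c (x r, u r)) (c (x₀, u 0)) (Ioi 0) 0 := by
  have hmem : Icc 0 s ∈ 𝓝[>] (0 : ℝ) := Icc_mem_nhdsGT hs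
  have hx : ContinuousWithinAt x (Ioi 0) 0 :=
    (h.continuousOn_state 0 ⟨le_rfl, hs.le⟩).mono_of_mem_nhdsWithin hmem
  have hcw : ContinuousWithinAt (fun r => c (x r, u r)) (Ioi 0) 0 :=
    hc.continuousAt.comp_continuousWithinAt (hx.prodMk (hu.mono Ioi_subset_Ici_self))
  have := intervalIntegral.integral_hasDerivWithinAt_right (a := 0) (b := 0) (s := Ici 0)
    (t := Ioi 0) (f := fun r => c (x r, u r)) (by simp)
    ⟨Icc 0 s, hmem, (h.integrableOn hc).aestronglyMeasurable⟩ hcw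
  rw [h.state_zero hs.le] at this
  exact this.mono Ioi_subset_Ici_self

theorem IsFeasiblePair.value_le {x₀ : EuclideanSpace ℝ (Fin n)}
    {x : ℝ → EuclideanSpace ℝ (Fin n)} {u : ℝ → EuclideanSpace ℝ (Fin m)}
    (h : M.IsFeasiblePair x₀ x u) : M.value x₀ ≤ M.cost x u :=
  iInf_le_of_le x (iInf_le_of_le u (iInf_le _ h))

/-- The value function decreases at least at the rate of the running cost along every curve that
leaves the initial state `x₀` of a feasible pair with the initial velocity of that pair. From
`y h` the control of the pair is used on `[h, T]`, which by the coincidence of the velocities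
costs only `o(h)` more than along `x`, and is followed for time `h` by a control supplied by the
terminal inequality at `x(T)`. -/
theorem eventually_value_add_le (hA : LocallyLipschitz M.A) (hB : LocallyLipschitz M.B)
    (hg : LocallyLipschitz (Function.uncurry M.g)) (hg0 : ∀ x u, 0 ≤ M.g x u)
    (hgpos : ∀ x u, (x, u) ≠ 0 → 0 < M.g x u) (hΦ : ContDiff ℝ 1 M.Φ) (hΦ0 : ∀ x, 0 ≤ M.Φ x)
    (hΦz : M.Φ 0 = 0) (hκ : 0 < M.κ) (hT : 0 < M.T) (hineq : M.TerminalInequality)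
    {x₀ : EuclideanSpace ℝ (Fin n)} {x y : ℝ → EuclideanSpace ℝ (Fin n)}
    {u : ℝ → EuclideanSpace ℝ (Fin m)} (hfeas : M.IsFeasiblePair x₀ x u)
    (hu : ContinuousWithinAt u (Ici 0) 0)
    (hy : HasDerivWithinAt y (M.field x₀ (u 0)) (Ioi 0) 0) (hy0 : y 0 = x₀) {ε : ℝ} (hε : 0 < ε) :
    ∀ᶠ h in 𝓝[>] (0 : ℝ), M.value (y h) + ENNReal.ofReal (h * M.g x₀ (u 0)) ≤
      M.cost x u + ENNReal.ofReal (ε * h) := by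
  obtain ⟨hx, hxT⟩ := isFeasiblePair_iff.1 hfeas
  obtain ⟨R, hR⟩ := isCompact_Icc.exists_bound_of_continuousOn hx.continuousOn_state
  obtain ⟨C, hC⟩ := hx.bounded_control
  obtain ⟨L, hL, hpert⟩ := hx.exists_perturbed hA hB
  obtain ⟨r, hr, δ, hδ, ρ, hρ, hterm⟩ := exists_isPath_terminal_near hA hB hg.continuous hg0 hgpos
    hΦ hΦ0 hΦz hκ hineq hxT (show 0 < ε / 4 by positivity)
  have hK : IsCompact (Metric.closedBall (0 : EuclideanSpace ℝ (Fin n)) (R + 1)) :=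
    isCompact_closedBall _ _
  obtain ⟨G, hG⟩ := hg.locallyLipschitzOn.exists_lipschitzOnWith_of_compact
    (hK.prod (isCompact_closedBall (0 : EuclideanSpace ℝ (Fin m)) C))
  obtain ⟨K, hKΦ⟩ := hΦ.locallyLipschitz.locallyLipschitzOn.exists_lipschitzOnWith_of_compact hK
  -- The error `d = L ‖y h - x h‖` enters the total cost with the factor `T G + K`.
  set N : ℝ := M.T * G + K + 1 with hN
  have hN0 : 0 < N := by positivity
  set μ : ℝ := min (ε / 4) ρ with hμ
  have hμ0 : 0 < μ := by positivity
  have hxderiv : HasDerivWithinAt x (M.field x₀ (u 0)) (Ioi 0) 0 := by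
    have h1 := (hx.hasDerivWithinAt_integral (continuous_field hA.continuous hB.continuous) hT
      hu).const_add x₀
    refine h1.congr_of_eventuallyEq ?_ (by simpa using hx.state_zero hT.le)
    filter_upwards [Icc_mem_nhdsGT hT] with t ht using hx.state_eq t ht
  have hdist : ∀ᶠ h in 𝓝[>] (0 : ℝ), ‖y h - x h‖ ≤ μ / (N * L) * h := by
    have h1 := (hasDerivWithinAt_iff_isLittleO.1 (hy.sub hxderiv)).def
      (show 0 < μ / (N * L) by positivity)
    filter_upwards [h1, self_mem_nhdsWithin] with h hh hpos
    simpa [hy0, hx.state_zero hT.le, abs_of_pos (show 0 < h from hpos)] using hh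
  have hcost : ∀ᶠ h in 𝓝[>] (0 : ℝ),
      h * M.g x₀ (u 0) ≤ (∫ t in (0 : ℝ)..h, M.g (x t) (u t)) + ε / 4 * h := by
    have h1 := (hasDerivWithinAt_iff_isLittleO.1
      (hx.hasDerivWithinAt_integral hg.continuous hT hu)).def (show 0 < ε / 4 by positivity)
    filter_upwards [h1, self_mem_nhdsWithin] with h hh hpos
    simp only [intervalIntegral.integral_same, sub_zero, smul_eq_mul, Real.norm_eq_abs,
      abs_of_pos (show 0 < h from hpos), Function.uncurry_apply_pair] at hh
    linarith [(abs_le.1 hh).1]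
  have hb : 0 < min (min M.T δ) (min 1 r * N / μ) := by positivity
  filter_upwards [hdist, hcost, Ioo_mem_nhdsGT hb] with h hd hc hh
  have hh0 : 0 < h := hh.1
  have hhT : h < M.T := hh.2.trans_le ((min_le_left _ _).trans (min_le_left _ _))
  have hhδ : h ≤ δ := (hh.2.trans_le ((min_le_left _ _).trans (min_le_right _ _))).le
  set d : ℝ := L * ‖y h - x h‖ with hddef
  have hd0 : 0 ≤ d := by positivity
  have hNd : N * d ≤ μ * h := by
    calc N * d ≤ N * (L * (μ / (N * L) * h)) := by rw [hddef]; gcongr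
      _ = μ * h := by field_simp
  have hdr : d < min 1 r := by
    have h1 : h * μ < min 1 r * N := (lt_div_iff₀ hμ0).1 (hh.2.trans_le (min_le_right _ _))
    have h2 : N * d < N * min 1 r := by linarith
    exact lt_of_mul_lt_mul_left h2 hN0.le
  have hmem : ∀ t ∈ Icc 0 (M.T - h), h + t ∈ Icc 0 M.T := fun t ht =>
    ⟨add_nonneg hh0.le ht.1, by linarith [ht.2]⟩
  have hTh : M.T - h ∈ Icc 0 (M.T - h) := ⟨by linarith, le_rfl⟩
  obtain ⟨p, hp, hpx⟩ := hpert h ⟨hh0.le, hhT.le⟩ (y h) (hdr.le.trans (min_le_left _ _))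
  have hxK : ∀ t ∈ Icc 0 M.T, x t ∈ Metric.closedBall (0 : EuclideanSpace ℝ (Fin n)) (R + 1) := by
    intro t ht
    simpa using (hR t ht).trans (by linarith)
  have hpK : ∀ t ∈ Icc 0 (M.T - h),
      p t ∈ Metric.closedBall (0 : EuclideanSpace ℝ (Fin n)) (R + 1) := by
    intro t ht
    have h1 : ‖p t‖ ≤ ‖x (h + t)‖ + ‖p t - x (h + t)‖ := norm_le_norm_add_norm_sub' _ _
    have h2 : d < 1 := hdr.trans_le (min_le_left _ _)
    simpa using h1.trans (by linarith [hR _ (hmem t ht), hpx t ht])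
  have hpT : ‖p (M.T - h) - x M.T‖ ≤ d := by simpa using hpx _ hTh
  have hΦp : M.Φ (p (M.T - h)) ≤ M.Φ (x M.T) + K * d := by
    have h1 := hKΦ.norm_sub_le (hpK _ hTh) (hxK M.T ⟨hT.le, le_rfl⟩)
    have h2 : (K : ℝ) * ‖p (M.T - h) - x M.T‖ ≤ K * d := by gcongr
    linarith [(abs_le.1 (h1.trans h2)).2]
  have hTG : 0 ≤ M.T * G * d := by positivity
  have hKd : 0 ≤ K * d := by positivity
  have hsum : M.T * G * d + K * d ≤ μ * h := by
    have : N * d = M.T * G * d + K * d + d := by rw [hN]; ring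
    linarith
  have hμρ : μ * h ≤ ρ * h := by gcongr; exact min_le_right _ _
  have hμε : μ * h ≤ ε / 4 * h := by gcongr; exact min_le_left _ _
  obtain ⟨k, v, hk, hkP, hkcost⟩ := hterm (p (M.T - h))
    (by rw [mem_ball_iff_norm]; exact hpT.trans_lt (hdr.trans_le (min_le_right _ _))) h
    ⟨hh0.le, hhδ⟩ (by linarith [show M.Φ (x M.T) ≤ M.κ from hxT])
  obtain ⟨z, w, hz, hze, hzcost⟩ := hp.append hA.continuous hB.continuous hTh.1 hh0.le hk
  rw [sub_add_cancel] at hz hze hzcost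
  have hvalue : M.value (y h) ≤ M.cost z w :=
    (isFeasiblePair_iff.2 ⟨hz, hze ▸ hkP⟩).value_le
  have hrun : M.runningCost (M.T - h) p (fun t => u (h + t)) ≤
      M.runningCost (M.T - h) (fun t => x (h + t)) (fun t => u (h + t)) +
        ENNReal.ofReal (M.T * G * d) := by
    have h1 : ∀ t ∈ Icc 0 (M.T - h), ENNReal.ofReal (M.g (p t) (u (h + t))) ≤
        ENNReal.ofReal (M.g (x (h + t)) (u (h + t))) + ENNReal.ofReal (G * d) := by
      intro t ht
      rw [← ENNReal.ofReal_add (hg0 _ _) (by positivity)]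
      refine ENNReal.ofReal_le_ofReal ?_
      have hut : u (h + t) ∈ Metric.closedBall (0 : EuclideanSpace ℝ (Fin m)) C := by
        simpa using hC _ (hmem t ht)
      have h2 := hG.norm_sub_le (x := (p t, u (h + t))) (y := (x (h + t), u (h + t)))
        ⟨hpK t ht, hut⟩ ⟨hxK _ (hmem t ht), hut⟩
      have h3 : ‖(p t, u (h + t)) - (x (h + t), u (h + t))‖ ≤ d := by
        rw [Prod.mk_sub_mk, sub_self, Prod.norm_mk, norm_zero, max_eq_left (norm_nonneg _)]
        exact hpx t ht
      have h4 : M.g (p t) (u (h + t)) - M.g (x (h + t)) (u (h + t)) ≤ G * d :=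
        (le_abs_self _).trans (h2.trans (by gcongr))
      linarith
    calc M.runningCost (M.T - h) p (fun t => u (h + t))
        ≤ ∫⁻ t in Icc 0 (M.T - h), (ENNReal.ofReal (M.g (x (h + t)) (u (h + t))) +
            ENNReal.ofReal (G * d)) := setLIntegral_mono' measurableSet_Icc h1
      _ = M.runningCost (M.T - h) (fun t => x (h + t)) (fun t => u (h + t)) +
            ENNReal.ofReal (G * d) * ENNReal.ofReal (M.T - h) := by
          rw [lintegral_add_right _ measurable_const, setLIntegral_const, Real.volume_Icc,
            sub_zero]
          rfl
      _ ≤ _ := by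
          rw [← ENNReal.ofReal_mul (by positivity)]
          have h5 : G * d * (M.T - h) ≤ G * d * M.T := by gcongr; linarith
          exact add_le_add le_rfl (ENNReal.ofReal_le_ofReal (by linarith))
  have hinit : ENNReal.ofReal (h * M.g x₀ (u 0)) ≤
      M.runningCost h x u + ENNReal.ofReal (ε / 4 * h) := by
    rw [(hx.mono hhT.le).runningCost_eq hg.continuous hg0 hh0.le, ← ENNReal.ofReal_add
      (intervalIntegral.integral_nonneg hh0.le fun t _ => hg0 _ _) (by positivity)]
    exact ENNReal.ofReal_le_ofReal hc
  have hΦp' : ENNReal.ofReal (M.Φ (p (M.T - h))) ≤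
      ENNReal.ofReal (M.Φ (x M.T)) + ENNReal.ofReal (K * d) := by
    rw [← ENNReal.ofReal_add (hΦ0 _) hKd]
    exact ENNReal.ofReal_le_ofReal hΦp
  have herr : ENNReal.ofReal (M.T * G * d) + ENNReal.ofReal (K * d) + ENNReal.ofReal (ε / 4 * h) +
      ENNReal.ofReal (ε / 4 * h) ≤ ENNReal.ofReal (ε * h) := by
    have h4 : 0 ≤ ε / 4 * h := by positivity
    rw [← ENNReal.ofReal_add hTG hKd, ← ENNReal.ofReal_add (by positivity) h4,
      ← ENNReal.ofReal_add (by positivity) h4]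
    exact ENNReal.ofReal_le_ofReal (by nlinarith)
  calc M.value (y h) + ENNReal.ofReal (h * M.g x₀ (u 0))
      ≤ (M.runningCost (M.T - h) p (fun t => u (h + t)) +
          (M.runningCost h k v + ENNReal.ofReal (M.Φ (k h)))) +
          (M.runningCost h x u + ENNReal.ofReal (ε / 4 * h)) := by
        refine add_le_add (hvalue.trans (le_of_eq ?_)) hinit
        rw [← add_assoc, ← hzcost, ← hze]
        rfl
    _ ≤ ((M.runningCost (M.T - h) (fun t => x (h + t)) (fun t => u (h + t)) +
          ENNReal.ofReal (M.T * G * d)) + ((ENNReal.ofReal (M.Φ (x M.T)) +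
          ENNReal.ofReal (K * d)) + ENNReal.ofReal (ε / 4 * h))) +
          (M.runningCost h x u + ENNReal.ofReal (ε / 4 * h)) := by
        exact add_le_add (add_le_add hrun (hkcost.trans (add_le_add hΦp' le_rfl))) le_rfl
    _ = ((M.runningCost h x u + M.runningCost (M.T - h) (fun t => x (h + t))
          (fun t => u (h + t))) + ENNReal.ofReal (M.Φ (x M.T))) +
          (ENNReal.ofReal (M.T * G * d) + ENNReal.ofReal (K * d) + ENNReal.ofReal (ε / 4 * h) +
          ENNReal.ofReal (ε / 4 * h)) := by ring
    _ ≤ M.cost x u + ENNReal.ofReal (ε * h) := by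
        refine add_le_add (le_of_eq ?_) herr
        rw [← IsPath.runningCost_shift ⟨hh0.le, hhT.le⟩]
        rfl

theorem IsFeasiblePair.cost_lt_top {x₀ : EuclideanSpace ℝ (Fin n)}
    {x : ℝ → EuclideanSpace ℝ (Fin n)} {u : ℝ → EuclideanSpace ℝ (Fin m)}
    (hg : Continuous (Function.uncurry M.g)) (h : M.IsFeasiblePair x₀ x u) : M.cost x u < ⊤ :=
  ENNReal.add_lt_top.2
    ⟨((isFeasiblePair_iff.1 h).1.integrableOn hg).lintegral_lt_top, ENNReal.ofReal_lt_top⟩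

theorem value_lt_top_iff (hg : Continuous (Function.uncurry M.g))
    {x₀ : EuclideanSpace ℝ (Fin n)} : M.value x₀ < ⊤ ↔ x₀ ∈ M.feasibleSet := by
  constructor
  · intro h
    simp only [value, iInf_lt_iff] at h
    obtain ⟨x, u, hxu, -⟩ := h
    exact ⟨x, u, hxu⟩
  · rintro ⟨x, u, h⟩
    exact h.value_le.trans_lt (h.cost_lt_top hg)

/-- A decrease of `V` by `h g(x, u)` up to `o(h)`, stated additively in `[0, ∞]`, bounds the
generalized directional derivative. -/
theorem upperDeriv_le {V : EuclideanSpace ℝ (Fin n) → ℝ≥0∞} {x : EuclideanSpace ℝ (Fin n)}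
    {u : EuclideanSpace ℝ (Fin m)} {a : ℝ} (ha : 0 ≤ a) (hV : V x ≠ ⊤)
    (h : ∀ ε > 0, ∀ᶠ h in 𝓝[>] (0 : ℝ),
      V (x + h • M.field x u) + ENNReal.ofReal (h * a) ≤ V x + ENNReal.ofReal (ε * h)) :
    M.upperDeriv V x u ≤ ((-a : ℝ) : EReal) := by
  rw [← EReal.le_of_forall_lt_iff_le]
  intro b hb
  have hb' : 0 < b + a := by
    have := EReal.coe_lt_coe_iff.1 hb
    linarith
  refine limsup_le_of_le (h := ?_)
  filter_upwards [h _ hb', self_mem_nhdsWithin] with t ht ht0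
  have ht0 : 0 < t := ht0
  have hfin : V (x + t • M.field x u) ≠ ⊤ := by
    refine ne_top_of_le_ne_top ?_ (le_self_add.trans ht)
    exact ENNReal.add_ne_top.2 ⟨hV, ENNReal.ofReal_ne_top⟩
  lift V (x + t • M.field x u) to NNReal using hfin with v'
  lift V x to NNReal using hV with v
  have hreal : (v' : ℝ) + t * a ≤ v + (b + a) * t := by
    rw [← ENNReal.ofReal_coe_nnreal (p := v'), ← ENNReal.ofReal_coe_nnreal (p := v),
      ← ENNReal.ofReal_add v'.coe_nonneg (by positivity),
      ← ENNReal.ofReal_add v.coe_nonneg (by positivity)] at ht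
    exact (ENNReal.ofReal_le_ofReal_iff (by positivity)).1 ht
  rw [EReal.coe_nnreal_eq_coe_real, EReal.coe_nnreal_eq_coe_real, ← EReal.coe_sub,
    ← EReal.coe_div, EReal.coe_le_coe_iff, div_le_iff₀ ht0]
  linarith

end MPCProblem

/-! ### Lower semicontinuous functions that decrease at a given rate -/

theorem mem_timeInterval {S : EReal} {t : ℝ} : t ∈ timeInterval S ↔ 0 ≤ t ∧ (t : EReal) < S :=
  Iff.rfl

theorem timeInterval_coe (t : ℝ) : timeInterval t = Ico 0 t := by
  ext s
  simp [mem_timeInterval]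

theorem timeInterval_mem_nhdsGT {S : EReal} {t : ℝ} (ht : t ∈ timeInterval S) :
    timeInterval S ∈ 𝓝[>] t := by
  obtain ⟨b, htb, hbS⟩ := EReal.lt_iff_exists_real_btwn.1 ht.2
  filter_upwards [Ioo_mem_nhdsGT (EReal.coe_lt_coe_iff.1 htb)] with s hs
  exact ⟨ht.1.trans hs.1.le, (EReal.coe_lt_coe_iff.2 hs.2).trans hbS⟩

theorem Icc_subset_timeInterval {S : EReal} {b : ℝ} (hb : b ∈ timeInterval S) :
    Icc 0 b ⊆ timeInterval S := fun _ ht =>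
  ⟨ht.1, (EReal.coe_le_coe_iff.2 ht.2).trans_lt hb.2⟩

/-- Continuity from below, for an integrand that need not be measurable. -/
theorem setLIntegral_timeInterval_eq_iSup (f : ℝ → ℝ≥0∞) (S : EReal) :
    ∫⁻ t in timeInterval S, f t =
      ⨆ q : {q : ℚ // ((q : ℝ) : EReal) < S}, ∫⁻ t in Ico (0 : ℝ) (q : ℚ), f t := by
  have hU : timeInterval S = ⋃ q : {q : ℚ // ((q : ℝ) : EReal) < S}, Ico (0 : ℝ) (q : ℚ) := by
    ext t
    simp only [mem_timeInterval, mem_iUnion, mem_Ico, Subtype.exists, exists_prop]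
    constructor
    · rintro ⟨h0, hS⟩
      obtain ⟨q, htq, hqS⟩ := EReal.lt_iff_exists_rat_btwn.1 hS
      exact ⟨q, hqS, h0, EReal.coe_lt_coe_iff.1 htq⟩
    · rintro ⟨q, hqS, h0, htq⟩
      exact ⟨h0, (EReal.coe_lt_coe_iff.2 htq).trans hqS⟩
  rw [hU, setLIntegral_iUnion_of_directed]
  refine Monotone.directed_le fun p q hpq => Ico_subset_Ico_right ?_
  exact_mod_cast hpq

theorem lowerSemicontinuous_setLIntegral_Ico (f : ℝ → ℝ≥0∞) :
    LowerSemicontinuous fun t : ℝ => ∫⁻ r in Ico 0 t, f r := by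
  intro t c hc
  change c < ∫⁻ r in Ico 0 t, f r at hc
  rw [← timeInterval_coe, setLIntegral_timeInterval_eq_iSup f t] at hc
  obtain ⟨⟨q, hqt⟩, hq⟩ := lt_iSup_iff.1 hc
  filter_upwards [Ioi_mem_nhds (EReal.coe_lt_coe_iff.1 hqt)] with s hs
  exact hq.trans_le (lintegral_mono_set (Ico_subset_Ico_right (le_of_lt hs)))

/-- If a lower semicontinuous `V` decreases at the rate `ℓ` to the right of every time at which it
is finite, and `ℓ` is there upper semicontinuous from the right, then the loss of `V` dominates the
integral of `ℓ`. The set of times up to which the inequality holds with an error `ε t` is closed by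
lower semicontinuity, and it cannot end because `V` remains finite on it. -/
theorem add_setLIntegral_le_of_eventually_add_le {V : ℝ → ℝ≥0∞} {ℓ : ℝ → ℝ} {b : ℝ}
    (hb : 0 ≤ b) (hlsc : LowerSemicontinuousOn V (Icc 0 b)) (hV0 : V 0 ≠ ⊤)
    (hℓ : ∀ t ∈ Ico 0 b, 0 ≤ ℓ t)
    (hdec : ∀ t ∈ Ico 0 b, V t ≠ ⊤ → ∀ ε > 0, ∀ᶠ s in 𝓝[>] t,
      V s + ENNReal.ofReal ((s - t) * ℓ t) ≤ V t + ENNReal.ofReal (ε * (s - t)))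
    (husc : ∀ t ∈ Ico 0 b, V t ≠ ⊤ → ∀ ε > 0, ∀ᶠ s in 𝓝[>] t, ℓ s ≤ ℓ t + ε) :
    V b + ∫⁻ t in Ico 0 b, ENNReal.ofReal (ℓ t) ≤ V 0 := by
  have key : ∀ ε > 0, V b + ∫⁻ t in Ico 0 b, ENNReal.ofReal (ℓ t) ≤
      V 0 + ENNReal.ofReal (ε * b) := by
    intro ε hε
    let I : ℝ → ℝ≥0∞ := fun t => ∫⁻ r in Ico 0 t, ENNReal.ofReal (ℓ r)
    let W : ℝ → ℝ≥0∞ := fun t => V t + I t + ENNReal.ofReal (ε * (b - t))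
    have hW : LowerSemicontinuousOn W (Icc 0 b) := by
      have h1 : Continuous fun t => ENNReal.ofReal (ε * (b - t)) :=
        ENNReal.continuous_ofReal.comp (by fun_prop)
      exact (hlsc.add ((lowerSemicontinuous_setLIntegral_Ico _).lowerSemicontinuousOn _)).add
        (h1.lowerSemicontinuous.lowerSemicontinuousOn _)
    have hW0 : W 0 = V 0 + ENNReal.ofReal (ε * b) := by simp [W, I]
    have hclosed : IsClosed ({t | W t ≤ W 0} ∩ Icc 0 b) := by
      obtain ⟨v, hv, hvW⟩ := lowerSemicontinuousOn_iff_preimage_Iic.1 hW (W 0)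
      have : {t | W t ≤ W 0} ∩ Icc 0 b = Icc 0 b ∩ v := by rw [inter_comm, ← hvW]; rfl
      rw [this]
      exact isClosed_Icc.inter hv
    have hext : ∀ t ∈ {t | W t ≤ W 0} ∩ Ico 0 b, ∀ y ∈ Ioi t,
        ({t | W t ≤ W 0} ∩ Ioc t y).Nonempty := by
      rintro t ⟨htW, ht⟩ y hy
      have hVt : V t ≠ ⊤ := by
        refine ne_top_of_le_ne_top ?_ ((le_self_add.trans le_self_add).trans
          (show V t + I t + ENNReal.ofReal (ε * (b - t)) ≤ W 0 from htW))
        rw [hW0]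
        exact ENNReal.add_ne_top.2 ⟨hV0, ENNReal.ofReal_ne_top⟩
      obtain ⟨c, htc, hc⟩ := mem_nhdsGT_iff_exists_Ioo_subset.1
        ((hdec t ht hVt _ (half_pos hε)).and (husc t ht hVt _ (half_pos hε)))
      obtain ⟨s, hts, hs⟩ := exists_between (lt_min (lt_min htc hy) ht.2)
      have hsc : s < c := hs.trans_le ((min_le_left _ _).trans (min_le_left _ _))
      have hsy : s < y := hs.trans_le ((min_le_left _ _).trans (min_le_right _ _))
      have hsb : s < b := hs.trans_le (min_le_right _ _)
      suffices hWs : W s ≤ W t from ⟨s, hWs.trans htW, hts, hsy.le⟩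
      have hst : 0 ≤ s - t := (sub_pos.2 hts).le
      have hℓt := hℓ t ht
      have hI : I s ≤ I t +
          (ENNReal.ofReal ((s - t) * ℓ t) + ENNReal.ofReal (ε / 2 * (s - t))) := by
        have h1 : I s = I t + ∫⁻ r in Ico t s, ENNReal.ofReal (ℓ r) := by
          simp only [I]
          rw [← lintegral_union measurableSet_Ico (Ico_disjoint_Ico_same),
            Ico_union_Ico_eq_Ico ht.1 hts.le]
        rw [h1]
        refine add_le_add le_rfl ?_
        calc ∫⁻ r in Ico t s, ENNReal.ofReal (ℓ r)
            ≤ ∫⁻ _ in Ico t s, ENNReal.ofReal (ℓ t + ε / 2) := by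
              refine setLIntegral_mono' measurableSet_Ico fun r hr => ENNReal.ofReal_le_ofReal ?_
              rcases hr.1.eq_or_lt with h2 | h2
              · subst h2
                linarith
              · exact (hc ⟨h2, hr.2.trans hsc⟩).2
          _ = ENNReal.ofReal ((s - t) * ℓ t) + ENNReal.ofReal (ε / 2 * (s - t)) := by
              rw [setLIntegral_const, Real.volume_Ico, ← ENNReal.ofReal_mul (by positivity),
                ← ENNReal.ofReal_add (by positivity) (by positivity)]
              congr 1
              ring
      have hsplit : ENNReal.ofReal (ε * (b - t)) = ENNReal.ofReal (ε / 2 * (s - t)) +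
          ENNReal.ofReal (ε / 2 * (s - t)) + ENNReal.ofReal (ε * (b - s)) := by
        have h3 : 0 ≤ b - s := (sub_pos.2 hsb).le
        rw [← ENNReal.ofReal_add (by positivity) (by positivity),
          ← ENNReal.ofReal_add (by positivity) (by positivity)]
        congr 1
        ring
      calc W s ≤ V s + (I t + (ENNReal.ofReal ((s - t) * ℓ t) +
            ENNReal.ofReal (ε / 2 * (s - t)))) + ENNReal.ofReal (ε * (b - s)) := by
            simp only [W]
            gcongr
        _ = (V s + ENNReal.ofReal ((s - t) * ℓ t)) + (I t +
            ENNReal.ofReal (ε / 2 * (s - t)) + ENNReal.ofReal (ε * (b - s))) := by ring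
        _ ≤ (V t + ENNReal.ofReal (ε / 2 * (s - t))) + (I t +
            ENNReal.ofReal (ε / 2 * (s - t)) + ENNReal.ofReal (ε * (b - s))) :=
            add_le_add (hc ⟨hts, hsc⟩).1 le_rfl
        _ = W t := by
            simp only [W]
            rw [hsplit]
            ring
    have hall := hclosed.Icc_subset_of_forall_exists_gt (show W 0 ≤ W 0 from le_rfl) hext
    have hWb : W b ≤ W 0 := hall ⟨hb, le_rfl⟩
    rw [hW0] at hWb
    simpa [W, I] using hWb
  refine ENNReal.le_of_forall_pos_le_add fun ε hε _ => ?_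
  refine (key (ε / (b + 1)) (by positivity)).trans (add_le_add le_rfl ?_)
  rw [← ENNReal.ofReal_coe_nnreal]
  refine ENNReal.ofReal_le_ofReal ?_
  rw [div_mul_eq_mul_div, div_le_iff₀ (by positivity)]
  nlinarith [ε.coe_nonneg]

namespace MPCProblem

variable {n m : ℕ} {M : MPCProblem n m}

/-! ### Closed-loop solutions -/

/-- Performance of the closed loop, given that the value function decreases along all curves with
the closed-loop velocity. -/
theorem IsClosedLoop.value_add_le (hg : Continuous (Function.uncurry M.g))
    (hg0 : ∀ x u, 0 ≤ M.g x u) {ω : EuclideanSpace ℝ (Fin n) → EuclideanSpace ℝ (Fin m)}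
    (hω : ContinuousOn ω M.feasibleSet)
    (hdec : ∀ x₀ ∈ M.feasibleSet, ∀ y : ℝ → EuclideanSpace ℝ (Fin n),
      HasDerivWithinAt y (M.field x₀ (ω x₀)) (Ioi 0) 0 → y 0 = x₀ → ∀ ε > 0,
        ∀ᶠ h in 𝓝[>] (0 : ℝ), M.value (y h) + ENNReal.ofReal (h * M.g x₀ (ω x₀)) ≤
          M.value x₀ + ENNReal.ofReal (ε * h))
    {x₀ : EuclideanSpace ℝ (Fin n)} (hx₀ : x₀ ∈ M.feasibleSet) {S : EReal}
    {x : ℝ → EuclideanSpace ℝ (Fin n)} (hx : M.IsClosedLoop ω (timeInterval S) x₀ x)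
    (hlsc : LowerSemicontinuousOn (fun t => M.value (x t)) (timeInterval S))
    {b : ℝ} (hb : b ∈ timeInterval S) :
    M.value (x b) + ∫⁻ t in Ico 0 b, ENNReal.ofReal (M.g (x t) (ω (x t))) ≤ M.value x₀ := by
  have hsub := Icc_subset_timeInterval hb
  have hderiv : ∀ t ∈ Ico 0 b, HasDerivWithinAt x (M.field (x t) (ω (x t))) (Ioi t) t := by
    intro t ht
    have htS := hsub (Ico_subset_Icc_self ht)
    exact (hx.2 t htS).mono_of_mem_nhdsWithin (timeInterval_mem_nhdsGT htS)
  have hV : ∀ t ∈ Ico 0 b, M.value (x t) ≠ ⊤ → ∀ ε > 0, ∀ᶠ s in 𝓝[>] t,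
      M.value (x s) + ENNReal.ofReal ((s - t) * M.g (x t) (ω (x t))) ≤
        M.value (x t) + ENNReal.ofReal (ε * (s - t)) := by
    intro t ht hVt ε hε
    have htend : Tendsto (fun s => s - t) (𝓝[>] t) (𝓝[>] 0) := by
      refine tendsto_nhdsWithin_iff.2 ⟨?_, ?_⟩
      · have h1 : Continuous fun s : ℝ => s - t := by fun_prop
        exact (h1.tendsto' t 0 (sub_self t)).mono_left nhdsWithin_le_nhds
      · filter_upwards [self_mem_nhdsWithin] with s hs using sub_pos.2 (show t < s from hs)
    have hy : HasDerivWithinAt (fun h => x (t + h)) (M.field (x t) (ω (x t))) (Ioi 0) 0 := by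
      have h1 : HasDerivWithinAt (fun h : ℝ => t + h) 1 (Ioi 0) 0 :=
        (hasDerivWithinAt_id 0 _).const_add t
      have h2 : HasDerivWithinAt x (M.field (x t) (ω (x t))) (Ioi t) (t + 0) := by
        rw [add_zero]
        exact hderiv t ht
      have h3 := h2.scomp (0 : ℝ) h1 fun h hh => by simpa using hh
      rwa [one_smul] at h3
    have := htend.eventually (hdec (x t) ((value_lt_top_iff hg).1 hVt.lt_top)
      (fun h => x (t + h)) hy (by simp) ε hε)
    simpa using this
  have := add_setLIntegral_le_of_eventually_add_le (V := fun t => M.value (x t))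
    (ℓ := fun t => M.g (x t) (ω (x t))) hb.1 (hlsc.mono hsub)
    (by simpa [hx.1] using ((value_lt_top_iff hg).2 hx₀).ne) (fun t _ => hg0 _ _) hV ?_
  · simpa [hx.1] using this
  · intro t ht hVt ε hε
    have hfeas : ∀ᶠ s in 𝓝[>] t, x s ∈ M.feasibleSet := by
      filter_upwards [hV t ht hVt 1 one_pos] with s hs
      refine (value_lt_top_iff hg).1 ((le_self_add.trans hs).trans_lt ?_)
      exact ENNReal.add_lt_top.2 ⟨hVt.lt_top, ENNReal.ofReal_lt_top⟩
    have hxt : Tendsto x (𝓝[>] t) (𝓝 (x t)) := (hderiv t ht).continuousWithinAt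
    have hωt : Tendsto (fun s => ω (x s)) (𝓝[>] t) (𝓝 (ω (x t))) :=
      (hω (x t) ((value_lt_top_iff hg).1 hVt.lt_top)).tendsto.comp
        (tendsto_nhdsWithin_iff.2 ⟨hxt, hfeas⟩)
    have hgt : Tendsto (fun s => M.g (x s) (ω (x s))) (𝓝[>] t) (𝓝 (M.g (x t) (ω (x t)))) :=
      (hg.tendsto (x t, ω (x t))).comp (hxt.prodMk_nhds hωt)
    filter_upwards [hgt.eventually_lt_const (lt_add_of_pos_right _ hε)] with s hs using hs.le

end MPCProblem

/-! ### The receding-horizon scheme -/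

theorem mainTheorem2 {n m : ℕ} (M : MPCProblem n m)
    (hA : LocallyLipschitz M.A) (hB : LocallyLipschitz M.B)
    (hg : LocallyLipschitz (Function.uncurry M.g))
    (hgpos : ∀ x u, (x, u) ≠ 0 → 0 < M.g x u)
    (hΦ : ContDiff ℝ (⊤ : ℕ∞) M.Φ) (hΦ0 : M.Φ 0 = 0) (hΦpos : ∀ x, x ≠ 0 → 0 < M.Φ x)
    (hκ : 0 < M.κ) (hP : Bornology.IsBounded M.terminalSet) (hT : 0 < M.T)
    (hineq : M.TerminalInequality) :
    M.RecursivelyFeasible ∧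
    ∀ ω : EuclideanSpace ℝ (Fin n) → EuclideanSpace ℝ (Fin m),
      M.IsOptimalControl ω → ContinuousOn ω M.feasibleSet →
        (∀ x ∈ M.feasibleSet, M.upperDeriv M.value x (ω x) ≤ ((-M.g x (ω x) : ℝ) : EReal)) ∧
        (∀ x₀ ∈ M.feasibleSet, ∀ (S : EReal) (x : ℝ → EuclideanSpace ℝ (Fin n)),
          M.IsClosedLoop ω (timeInterval S) x₀ x →
          LowerSemicontinuousOn (fun t => M.value (x t)) (timeInterval S) →
            (∀ t ∈ timeInterval S, x t ∈ M.feasibleSet) ∧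
            ∫⁻ t in timeInterval S, ENNReal.ofReal (M.g (x t) (ω (x t))) ≤ M.value x₀) := by
  have hgc : Continuous (Function.uncurry M.g) := hg.continuous
  have hΦ1 : ContDiff ℝ 1 M.Φ := hΦ.of_le (by exact_mod_cast le_top)
  have hΦnn : ∀ x, 0 ≤ M.Φ x := by
    intro x
    rcases eq_or_ne x 0 with rfl | hx
    · exact hΦ0.ge
    · exact (hΦpos x hx).le
  rcases subsingleton_or_nontrivial (EuclideanSpace ℝ (Fin n) × EuclideanSpace ℝ (Fin m)) with
    hsub | hnt
  · -- In dimension zero positivity says nothing about `g 0 0`, but the terminal inequality then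
    -- forces `g ≤ 0`, and the value function is constant.
    have hE : Subsingleton (EuclideanSpace ℝ (Fin n)) := (Prod.fst_surjective
      (α := EuclideanSpace ℝ (Fin n)) (β := EuclideanSpace ℝ (Fin m))).subsingleton
    have hF : Subsingleton (EuclideanSpace ℝ (Fin m)) := (Prod.snd_surjective
      (α := EuclideanSpace ℝ (Fin n)) (β := EuclideanSpace ℝ (Fin m))).subsingleton
    have hgle : ∀ x u, M.g x u ≤ 0 := by
      intro x u
      obtain ⟨v, -, hv⟩ := hineq x (show M.Φ x ≤ M.κ by
        rw [Subsingleton.elim x 0, hΦ0]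
        exact hκ.le)
      rwa [Subsingleton.elim (M.field x v) 0, map_zero, zero_add, Subsingleton.elim v u] at hv
    refine ⟨fun x₀ x u h τ _ => ?_, fun ω _ _ => ⟨fun x hx => ?_, fun x₀ hx₀ S x _ _ => ⟨?_, ?_⟩⟩⟩
    · rw [Subsingleton.elim (x τ) x₀]
      exact ⟨x, u, h⟩
    · have hne : (M.value x : EReal) ≠ ⊤ := by
        simpa using ((MPCProblem.value_lt_top_iff hgc).2 hx).ne
      have hconst : M.upperDeriv M.value x (ω x) = 0 := by
        unfold MPCProblem.upperDeriv
        have : ∀ h : ℝ, x + h • M.field x (ω x) = x := fun h => Subsingleton.elim _ _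
        simp only [this, EReal.sub_self hne (EReal.coe_ennreal_ne_bot _), EReal.zero_div]
        exact limsup_const 0
      rw [hconst]
      exact_mod_cast neg_nonneg.2 (hgle x (ω x))
    · intro t _
      rwa [Subsingleton.elim (x t) x₀]
    · simp [ENNReal.ofReal_of_nonpos (hgle _ _)]
  · have hg0 := MPCProblem.g_nonneg hgc hgpos
    refine ⟨MPCProblem.recursivelyFeasible hA hB hgc hg0 hgpos hΦ1 hΦnn hΦ0 hκ hP hineq,
      fun ω hω hωc => ?_⟩
    have hdec : ∀ x₀ ∈ M.feasibleSet, ∀ y : ℝ → EuclideanSpace ℝ (Fin n),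
        HasDerivWithinAt y (M.field x₀ (ω x₀)) (Ioi 0) 0 → y 0 = x₀ → ∀ ε > 0,
          ∀ᶠ h in 𝓝[>] (0 : ℝ), M.value (y h) + ENNReal.ofReal (h * M.g x₀ (ω x₀)) ≤
            M.value x₀ + ENNReal.ofReal (ε * h) := by
      intro x₀ hx₀ y hy hy0 ε hε
      obtain ⟨x, u, hfeas, hopt, hu0, hu⟩ := hω x₀ hx₀
      rw [← hopt, ← hu0]
      rw [← hu0] at hy
      exact MPCProblem.eventually_value_add_le hA hB hg hg0 hgpos hΦ1 hΦnn hΦ0 hκ hT hineq hfeas hu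
        hy hy0 hε
    refine ⟨fun x hx => ?_, fun x₀ hx₀ S x hx hlsc => ?_⟩
    · refine MPCProblem.upperDeriv_le (hg0 _ _) ((MPCProblem.value_lt_top_iff hgc).2 hx).ne ?_
      refine hdec x hx _ ?_ (by simp)
      have h1 : HasDerivAt (fun h : ℝ => x + h • M.field x (ω x))
          ((1 : ℝ) • M.field x (ω x)) 0 := ((hasDerivAt_id 0).smul_const _).const_add x
      rw [one_smul] at h1
      exact h1.hasDerivWithinAt
    · have hmain := fun t (ht : t ∈ timeInterval S) =>
        hx.value_add_le hgc hg0 hωc hdec hx₀ hlsc ht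
      refine ⟨fun t ht => (MPCProblem.value_lt_top_iff hgc).1
        ((le_self_add.trans (hmain t ht)).trans_lt ((MPCProblem.value_lt_top_iff hgc).2 hx₀)), ?_⟩
      rw [setLIntegral_timeInterval_eq_iSup]
      refine iSup_le fun q => ?_
      rcases le_or_gt 0 ((q : ℚ) : ℝ) with hq | hq
      · exact le_add_self.trans (hmain _ ⟨hq, q.2⟩)
      · simp [Ico_eq_empty_of_le hq.le]
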